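/- Let $E$ be a complex Banach space, $X$ a Hausdorff locally convex complex topological vector space, and let $E\subseteq X$ with continuous linear inclusion. For a locally convex space $Y$ let $\mathcal{S}'(\mathbb{R}^n,Y)$ be the space of continuous linear maps $\mathcal{S}(\mathbb{R}^n)\to Y$, so that $\mathcal{S}'(\mathbb{R}^n,E)\subseteq\mathcal{S}'(\mathbb{R}^n,X)$. Write $\hat\varphi(u)=\int_{\mathbb{R}^n}\varphi(t)e^{-iu\cdot t}\,\mathrm{d}t$, $\langle\hat{\mathbf f},\rho\rangle=\langle\mathbf f,\hat\rho\rangle$, $\varphi_y(t)=y^{-n}\varphi(t/y)$, and $$M^{\mathbf f}_\varphi(x,y)=(\mathbf f\ast\varphi_y)(x),\qquad (x,y)\in\mathbb{R}^n\times(0,\infty).$$ Let $\mathbf f\in\mathcal{S}'(\mathbb{R}^n,X)$ and let $\varphi\in\mathcal{S}(\mathbb{R}^n)$ be non-degenerate, that is, for every unit vector $\omega\in\mathbb{R}^n$ the function $r\mapsto\hat\varphi(r\omega)$, $r\ge 0$, is not identically zero. Assume: (i) $M^{\mathbf f}_\varphi(x,y)\in E$ for almost all $(x,y)\in\mathbb{R}^n\times(0,\infty)$,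 and $M^{\mathbf f}_\varphi$ is (Bochner) measurable as an $E$-valued function; (ii) there are $k,l\in\mathbb{N}$ such that $$\int_0^\infty\!\!\int_{\mathbb{R}^n}\Big(\frac1y+y\Big)^{-k}(1+|x|)^{-l}\,\|M^{\mathbf f}_\varphi(x,y)\|_E\,\mathrm{d}x\,\mathrm{d}y<\infty .$$ Then there is $\mathbf G\in\mathcal{S}'(\mathbb{R}^n,X)$ such that $\mathbf f-\mathbf G\in\mathcal{S}'(\mathbb{R}^n,E)$ and $\operatorname{supp}\hat{\mathbf G}\subseteq\{0\}$. Moreover, $$P_q^\varphi\Big(\frac{\partial}{\partial t}\Big)\mathbf f\in\mathcal{S}'(\mathbb{R}^n,E)\qquad\text{for all } q\in\mathbb{N}=\{0,1,2,\dots\},$$ where $P_q^\varphi(u)=\sum_{|m|=q}\frac{\hat\varphi^{(m)}(0)}{m!}u^m$ is the $q$-homogeneous term of the Taylor expansion of $\hat\varphi$ at the origin. -/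

import Mathlib

open MeasureTheory
open scoped SchwartzMap FourierTransform LineDeriv

noncomputable section

namespace ClassEstimate

/-- Euclidean space `ℝⁿ`. -/
abbrev Rn (n : ℕ) : Type := EuclideanSpace ℝ (Fin n)

variable {n : ℕ}

/-- Lebesgue measure `dx dy` on the upper half-space `ℍⁿ⁺¹ = ℝⁿ × (0, ∞)`. -/
def halfSpaceMeasure (n : ℕ) : Measure (Rn n × ℝ) :=
  (volume : Measure (Rn n × ℝ)).restrict {p | 0 < p.2}

/-! ### The Fourier transform with kernel `exp (-i u · t)` -/

/-- The homothety `u ↦ u / (2π)` of `ℝⁿ`. -/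
def divTwoPi (n : ℕ) : Rn n ≃L[ℝ] Rn n :=
  ContinuousLinearEquiv.smulLeft (Units.mk0 (2 * Real.pi)⁻¹ (inv_ne_zero Real.two_pi_pos.ne'))

/-- The Fourier transform `φ̂ (u) = ∫ φ (t) exp (-i u · t) dt` as a continuous linear operator on
Schwartz functions (`fourierS_apply` gives the formula). Mathlib's transform has the kernel
`exp (-2 π i u · t)`, so that it is evaluated at `u / (2π)`. -/
def fourierS (n : ℕ) : 𝓢(Rn n, ℂ) →L[ℂ] 𝓢(Rn n, ℂ) :=
  (SchwartzMap.compCLMOfContinuousLinearEquiv ℂ (divTwoPi n)) ∘L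
    (FourierTransform.fourierCLM ℂ 𝓢(Rn n, ℂ))

theorem fourierS_apply (φ : 𝓢(Rn n, ℂ)) (u : Rn n) :
    fourierS n φ u = ∫ t, φ t * Complex.exp (-Complex.I * (inner ℝ u t : ℝ)) := by
  have h : fourierS n φ u = (𝓕 (φ : Rn n → ℂ)) ((2 * Real.pi)⁻¹ • u) := rfl
  rw [h, Real.fourier_eq']
  refine integral_congr_ae (Filter.Eventually.of_forall fun t => ?_)
  have hpi : (Real.pi : ℂ) ≠ 0 := by exact_mod_cast Real.pi_ne_zero
  simp only [smul_eq_mul, inner_smul_right, real_inner_comm t u]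
  rw [mul_comm]
  congr 2
  push_cast
  field_simp

/-- The test function `φ` is non-degenerate: `φ̂` does not vanish identically on any ray
`{r ω : r ≥ 0}`, `|ω| = 1`. -/
def NonDegenerate (φ : 𝓢(Rn n, ℂ)) : Prop :=
  ∀ ω : Rn n, ‖ω‖ = 1 → ∃ r : ℝ, 0 ≤ r ∧ fourierS n φ (r • ω) ≠ 0

/-! ### The regularizing transform -/

/-- `φ_y (t) = y⁻ⁿ φ (t / y)` for `y > 0` (and the value `0` for `y ≤ 0`, which is never used). -/
def dilate (φ : 𝓢(Rn n, ℂ)) (y : ℝ) : 𝓢(Rn n, ℂ) :=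
  if hy : 0 < y then
    ((y ^ n)⁻¹ : ℝ) • SchwartzMap.compCLMOfContinuousLinearEquiv ℂ
      (ContinuousLinearEquiv.smulLeft (Units.mk0 y⁻¹ (inv_ne_zero hy.ne')) : Rn n ≃L[ℝ] Rn n) φ
  else 0

theorem dilate_apply (φ : 𝓢(Rn n, ℂ)) {y : ℝ} (hy : 0 < y) (t : Rn n) :
    dilate φ y t = ((y ^ n)⁻¹ : ℝ) * φ (y⁻¹ • t) := by
  rw [dilate, dif_pos hy]
  exact Complex.real_smul

/-- The test function `t ↦ φ (x - t)`. -/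
def reflectAt (φ : 𝓢(Rn n, ℂ)) (x : Rn n) : 𝓢(Rn n, ℂ) :=
  SchwartzMap.compSubConstCLM ℂ x
    (SchwartzMap.compCLMOfContinuousLinearEquiv ℂ (ContinuousLinearEquiv.neg ℝ) φ)

theorem reflectAt_apply (φ : 𝓢(Rn n, ℂ)) (x t : Rn n) : reflectAt φ x t = φ (x - t) := by
  have h : reflectAt φ x t = φ (-(t - x)) := rfl
  rw [h, neg_sub]

section TVS

variable {X : Type*} [AddCommGroup X] [Module ℂ X] [TopologicalSpace X]

/-- The regularizing transform `M_φ^f (x, y) = (f ∗ φ_y) (x) = ⟨f (t), φ_y (x - t)⟩` of a vector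
valued tempered distribution, for `y > 0`. -/
def regTransform (f : 𝓢'(Rn n, X)) (φ : 𝓢(Rn n, ℂ)) (x : Rn n) (y : ℝ) : X :=
  f (reflectAt (dilate φ y) x)

/-- The `X`-valued tempered distribution `f` belongs to `𝓢'(ℝⁿ, E)`, where `E` is regarded as a
subspace of `X` through `ι`: it is a continuous linear map from `𝓢(ℝⁿ)` to `E` followed by `ι`. -/
def IsValuedIn {E : Type*} [NormedAddCommGroup E] [NormedSpace ℂ E] (ι : E →L[ℂ] X)
    (f : 𝓢'(Rn n, X)) : Prop :=
  ∃ g : 𝓢'(Rn n, E), ∀ ρ : 𝓢(Rn n, ℂ), f ρ = ι (g ρ)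

variable [IsTopologicalAddGroup X] [ContinuousConstSMul ℂ X]

/-- The Fourier transform of a vector valued tempered distribution, `⟨f̂, ρ⟩ = ⟨f, ρ̂⟩`. -/
def fourierD (f : 𝓢'(Rn n, X)) : 𝓢'(Rn n, X) :=
  PointwiseConvergenceCLM.precomp X (fourierS n) f

end TVS

/-! ### Taylor polynomials and differential operators -/

/-- The partial derivative `∂^m f = ∂₁^{m₁} ⋯ ∂ₙ^{mₙ} f` for a multi-index `m`, both for Schwartz
functions and for tempered distributions. -/
def partialDeriv {V : Type*} [LineDeriv (Rn n) V V] (m : Fin n →₀ ℕ) (f : V) : V :=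
  (List.finRange n).foldr
    (fun i g => (fun h : V => ∂_{(EuclideanSpace.single i (1 : ℝ) : Rn n)} h)^[m i] g) f

/-- The `q`-homogeneous term `P_q^φ (u) = ∑_{|m| = q} φ̂^{(m)} (0) / m! u^m` of the Taylor expansion
of `φ̂` at the origin. -/
def taylorTerm (φ : 𝓢(Rn n, ℂ)) (q : ℕ) : MvPolynomial (Fin n) ℂ :=
  ∑ m ∈ (Finset.univ : Finset (Fin n)).finsuppAntidiag q,
    MvPolynomial.monomial m (partialDeriv m (fourierS n φ) 0 / ((∏ i, (m i).factorial : ℕ) : ℂ))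

/-- The constant coefficient differential operator `P(∂) f = ∑_m c_m ∂^m f`, where
`P (u) = ∑_m c_m u^m`, on vector valued tempered distributions. -/
def diffOp {X : Type*} [AddCommGroup X] [Module ℂ X] [TopologicalSpace X]
    [IsTopologicalAddGroup X] [ContinuousConstSMul ℂ X]
    (P : MvPolynomial (Fin n) ℂ) (f : 𝓢'(Rn n, X)) : 𝓢'(Rn n, X) :=
  ∑ m ∈ P.support, P.coeff m • partialDeriv m f

end ClassEstimate

end

/-!
Write `Φ_p (t) = φ_y (x - t)` for `p = (x, y)` in the half-space (`atom`), so that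
`M_φ^f (p) = ⟨f, Φ_p⟩`. Whatever test function can be written as a superposition `∫ K (p) Φ_p dp`
with a rapidly decaying kernel `K`, the value of `f` on it is the Bochner integral
`∫ K (p) M_φ^f (p) dp`, an element of `E` (`apply_superposition`; since `X` is only locally convex,
the identity is tested with continuous functionals, which separate the points of `X`). By the growth
assumption this integral depends continuously on `ρ` when `K = K_ρ` does, in the sense of one weighted
supremum bound (`exists_clm_integral_smul`). Both assertions come from a choice of the kernel, made on
the Fourier side, where `𝓕 Φ_p (ξ) = exp (-2πi x·ξ) 𝓕φ (-yξ)` (`fourier_atom`).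

*High frequencies.* Non-degeneracy and compactness of the sphere provide a smooth `θ`, supported in an
annulus, with `∫ 𝓕φ (-yξ) θ (yξ) dy/y = 1` for `ξ ≠ 0` (`exists_reconstruction`). The kernel
`y⁻¹ 𝓕⁻[θ (y ·) 𝓕σ] (x)` then reproduces `σ` if `𝓕σ` is flat, i.e. vanishes to infinite order at the
origin (`eq_of_superposition_synthKernel`). For the growth rate at hand, vanishing to some finite order
`N` is enough for the decay of the kernel, and the functions `σ` with `𝓕σ` vanishing to order `N` form
a closed subspace of finite codimension. Composing with a continuous projection onto it gives an
`E`-valued distribution `g` with `f σ = g σ` whenever `𝓕σ` is flat (`exists_clm_eq_of_isFlat`). Put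
`G = f - g`: if `ρ` vanishes near the origin, then the Fourier transform of `ρ̂` is flat, so
`⟨Ĝ, ρ⟩ = 0`.

*Low frequencies.* Let `κ` be a rapidly decreasing function on the half-line all of whose moments
vanish, except the `q`-th, which is `1` (`exists_isMomentFunction`; such functions exist since the
moment problem is indeterminate for the log-normal density). The superposition `ρ_κ` with the kernel
`κ (y) ρ (x)` has `𝓕ρ_κ (ξ) = 𝓕ρ (ξ) ∫ κ (y) 𝓕φ (-yξ) dy`, and by Taylor's formula the integral equals
the `q`-homogeneous Taylor term of `𝓕φ (-ξ)` up to a flat error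
(`exists_integral_moment_sub_le`). Hence `P_q(∂) f` tested on `ρ` is, up to a power of `i`, the value
of `f` on `ρ_κ` plus its value on a function with flat Fourier transform (`isFlat_fourier_sub`), and
both values lie in `E` and depend continuously on `ρ`.
-/

noncomputable section

namespace ClassEstimate

variable {n : ℕ}


/-! ### Integrals of families of Schwartz functions -/

section SchwartzIntegral

open scoped BoundedContinuousFunction ContDiff

variable {D : Type*} [NormedAddCommGroup D] [NormedSpace ℝ D]

/-- The space of values of `b`-th derivatives of complex functions on `D`, a type synonym whose
topology is the one of the operator norm by definition. -/
def DerivValue (D : Type*) [NormedAddCommGroup D] [NormedSpace ℝ D] (b : ℕ) : Type _ :=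
  D [×b]→L[ℝ] ℂ

instance (b : ℕ) : NormedAddCommGroup (DerivValue D b) :=
  inferInstanceAs (NormedAddCommGroup (D [×b]→L[ℝ] ℂ))

instance (b : ℕ) : NormedSpace ℂ (DerivValue D b) :=
  inferInstanceAs (NormedSpace ℂ (D [×b]→L[ℝ] ℂ))

instance (b : ℕ) : NormedSpace ℝ (DerivValue D b) :=
  inferInstanceAs (NormedSpace ℝ (D [×b]→L[ℝ] ℂ))

instance (b : ℕ) : SMulCommClass ℝ ℂ (DerivValue D b) :=
  inferInstanceAs (SMulCommClass ℝ ℂ (D [×b]→L[ℝ] ℂ))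

instance (b : ℕ) : CompleteSpace (DerivValue D b) :=
  inferInstanceAs (CompleteSpace (D [×b]→L[ℝ] ℂ))

/-- The `b`-th derivative of a Schwartz function. -/
def derivValue (b : ℕ) (ρ : 𝓢(D, ℂ)) (t : D) : DerivValue D b := iteratedFDeriv ℝ b ρ t

theorem continuous_derivValue (b : ℕ) (ρ : 𝓢(D, ℂ)) : Continuous (derivValue b ρ) :=
  (ρ.smooth ⊤).continuous_iteratedFDeriv (mod_cast le_top)

/-- Currying of the first variable. -/
def curryDerivValue (D : Type*) [NormedAddCommGroup D] [NormedSpace ℝ D] (b : ℕ) :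
    DerivValue D (b + 1) →L[ℝ] (D →L[ℝ] DerivValue D b) :=
  LinearMap.mkContinuous
    { toFun := fun x => ContinuousMultilinearMap.curryLeft (Ei := fun _ : Fin (b + 1) => D) x
      map_add' := fun _ _ => rfl
      map_smul' := fun _ _ => rfl } 1 fun x => by
    rw [one_mul]
    exact (ContinuousMultilinearMap.curryLeft_norm (Ei := fun _ : Fin (b + 1) => D) x).le

theorem norm_curryDerivValue_le (b : ℕ) (x : DerivValue D (b + 1)) :
    ‖curryDerivValue D b x‖ ≤ ‖x‖ :=
  (ContinuousMultilinearMap.curryLeft_norm (Ei := fun _ : Fin (b + 1) => D) x).le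

theorem hasFDerivAt_derivValue (b : ℕ) (ρ : 𝓢(D, ℂ)) (t : D) :
    HasFDerivAt (derivValue b ρ) (curryDerivValue D b (derivValue (b + 1) ρ t)) t := by
  have h := (((ρ.smooth ⊤).differentiable_iteratedFDeriv
    (m := b) (mod_cast ENat.natCast_lt_top b)) t).hasFDerivAt
  exact h

theorem derivValue_add (b : ℕ) (f g : 𝓢(D, ℂ)) (t : D) :
    derivValue b (f + g) t = derivValue b f t + derivValue b g t :=
  iteratedFDeriv_add_apply (f.smooth b).contDiffAt (g.smooth b).contDiffAt

theorem derivValue_smul (b : ℕ) (c : ℂ) (f : 𝓢(D, ℂ)) (t : D) :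
    derivValue b (c • f) t = c • derivValue b f t :=
  iteratedFDeriv_const_smul_apply (f.smooth b).contDiffAt

theorem norm_weight_smul_derivValue (a b : ℕ) (ρ : 𝓢(D, ℂ)) (t : D) :
    ‖((‖t‖ ^ a : ℝ) : ℂ) • derivValue b ρ t‖ = ‖t‖ ^ a * ‖iteratedFDeriv ℝ b ρ t‖ := by
  rw [norm_smul, Complex.norm_real, norm_pow, norm_norm]; rfl

/-- The map `ρ ↦ (t ↦ |t|ᵃ Dᵇρ(t))` from Schwartz functions to bounded continuous functions. The
norms of these maps are the Schwartz seminorms. -/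
def weightedDerivCLM (D : Type*) [NormedAddCommGroup D] [NormedSpace ℝ D] (a b : ℕ) :
    𝓢(D, ℂ) →L[ℂ] (D →ᵇ DerivValue D b) :=
  SchwartzMap.mkCLMtoNormedSpace (𝕜 := ℂ) (𝕜' := ℂ) (σ := RingHom.id ℂ)
    (fun ρ => BoundedContinuousFunction.ofNormedAddCommGroup
      (fun t => ((‖t‖ ^ a : ℝ) : ℂ) • derivValue b ρ t)
      ((Complex.continuous_ofReal.comp (continuous_norm.pow a)).smul (continuous_derivValue b ρ))
      (SchwartzMap.seminorm ℂ a b ρ)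
      (fun t => (norm_weight_smul_derivValue a b ρ t).trans_le (ρ.le_seminorm ℂ a b t)))
    (fun f g => by
      ext t : 1
      simp [derivValue_add, smul_add])
    (fun c f => by
      ext t : 1
      simp [derivValue_smul, smul_comm c])
    ⟨{(a, b)}, 1, zero_le_one, fun f => by
      refine (BoundedContinuousFunction.norm_ofNormedAddCommGroup_le _ (apply_nonneg _ _) _).trans ?_
      simp [SchwartzMap.schwartzSeminormFamily_apply]⟩

theorem weightedDerivCLM_apply (a b : ℕ) (ρ : 𝓢(D, ℂ)) (t : D) :
    weightedDerivCLM D a b ρ t = ((‖t‖ ^ a : ℝ) : ℂ) • derivValue b ρ t := rfl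

theorem seminorm_le_norm_weightedDerivCLM (a b : ℕ) (ρ : 𝓢(D, ℂ)) :
    SchwartzMap.seminorm ℂ a b ρ ≤ ‖weightedDerivCLM D a b ρ‖ := by
  refine SchwartzMap.seminorm_le_bound ℂ a b ρ (norm_nonneg _) fun t => ?_
  have := (weightedDerivCLM D a b ρ).norm_coe_le_norm t
  rwa [weightedDerivCLM_apply, norm_weight_smul_derivValue] at this

theorem norm_weightedDerivCLM_le (a b : ℕ) (ρ : 𝓢(D, ℂ)) :
    ‖weightedDerivCLM D a b ρ‖ ≤ SchwartzMap.seminorm ℂ a b ρ :=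
  (BoundedContinuousFunction.norm_le (apply_nonneg _ _)).2 fun t => by
    rw [weightedDerivCLM_apply, norm_weight_smul_derivValue]; exact ρ.le_seminorm ℂ a b t

variable {P : Type*} [MeasurableSpace P] {μ : Measure P} {K : P → ℂ} {Φ : P → 𝓢(D, ℂ)}

theorem integrable_smul_weightedDerivCLM (hΦ : AEStronglyMeasurable Φ μ)
    (hK : AEStronglyMeasurable K μ)
    (hint : ∀ a b : ℕ, Integrable (fun p => ‖K p‖ * SchwartzMap.seminorm ℂ a b (Φ p)) μ)
    (a b : ℕ) : Integrable (fun p => K p • weightedDerivCLM D a b (Φ p)) μ := by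
  refine (hint a b).mono'
    (hK.smul ((weightedDerivCLM D a b).continuous.comp_aestronglyMeasurable hΦ)) ?_
  refine Filter.Eventually.of_forall fun p => ?_
  rw [norm_smul]
  exact mul_le_mul_of_nonneg_left (norm_weightedDerivCLM_le a b (Φ p)) (norm_nonneg _)

theorem integrable_smul_derivValue (hΦ : AEStronglyMeasurable Φ μ)
    (hK : AEStronglyMeasurable K μ)
    (hint : ∀ a b : ℕ, Integrable (fun p => ‖K p‖ * SchwartzMap.seminorm ℂ a b (Φ p)) μ)
    (b : ℕ) (t : D) : Integrable (fun p => K p • derivValue b (Φ p) t) μ := by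
  have h := (BoundedContinuousFunction.evalCLM ℂ t).integrable_comp
    (integrable_smul_weightedDerivCLM hΦ hK hint 0 b)
  refine h.congr (Filter.Eventually.of_forall fun p => ?_)
  simp [weightedDerivCLM_apply]

theorem hasFDerivAt_integral_smul_derivValue (hΦ : AEStronglyMeasurable Φ μ)
    (hK : AEStronglyMeasurable K μ)
    (hint : ∀ a b : ℕ, Integrable (fun p => ‖K p‖ * SchwartzMap.seminorm ℂ a b (Φ p)) μ)
    (b : ℕ) (t : D) : HasFDerivAt (fun t => ∫ p, K p • derivValue b (Φ p) t ∂μ)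
      (curryDerivValue D b (∫ p, K p • derivValue (b + 1) (Φ p) t ∂μ)) t := by
  have hi := integrable_smul_derivValue hΦ hK hint (b + 1) t
  rw [← ContinuousLinearMap.integral_comp_comm _ hi]
  refine hasFDerivAt_integral_of_dominated_of_fderiv_le (s := Set.univ)
    (F' := fun t p => curryDerivValue D b (K p • derivValue (b + 1) (Φ p) t))
    (bound := fun p => ‖K p‖ * SchwartzMap.seminorm ℂ 0 (b + 1) (Φ p)) Filter.univ_mem
    (Filter.Eventually.of_forall fun x =>
      (integrable_smul_derivValue hΦ hK hint b x).aestronglyMeasurable)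
    (integrable_smul_derivValue hΦ hK hint b t)
    ((curryDerivValue D b).integrable_comp hi).aestronglyMeasurable
    (Filter.Eventually.of_forall fun p x _ => ?_) (hint 0 (b + 1))
    (Filter.Eventually.of_forall fun p x _ => ?_)
  · refine (norm_curryDerivValue_le b _).trans ?_
    rw [norm_smul]
    exact mul_le_mul_of_nonneg_left
      ((Φ p).norm_iteratedFDeriv_le_seminorm ℂ (b + 1) x) (norm_nonneg _)
  · exact (hasFDerivAt_derivValue b (Φ p) x).const_smul (K p)

/-- The integral `t ↦ ∫ K(p) Φ(p)(t) dp` of a family of Schwartz functions, all of whose seminorms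
are integrable, is a Schwartz function. -/
theorem exists_schwartz_integral (hΦ : AEStronglyMeasurable Φ μ)
    (hK : AEStronglyMeasurable K μ)
    (hint : ∀ a b : ℕ, Integrable (fun p => ‖K p‖ * SchwartzMap.seminorm ℂ a b (Φ p)) μ) :
    ∃ σ : 𝓢(D, ℂ),
      (∀ (b : ℕ) (t : D), derivValue b σ t = ∫ p, K p • derivValue b (Φ p) t ∂μ) ∧
      (∀ t, σ t = ∫ p, K p * Φ p t ∂μ) ∧
      ∀ a b : ℕ, SchwartzMap.seminorm ℂ a b σ ≤
        ∫ p, ‖K p‖ * SchwartzMap.seminorm ℂ a b (Φ p) ∂μ := by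
  let ψ : D → FormalMultilinearSeries ℝ D ℂ := fun t b => ∫ p, K p • derivValue b (Φ p) t ∂μ
  have hψ : ∀ b t, HasFDerivAt (ψ · b) (ψ t (b + 1)).curryLeft t :=
    hasFDerivAt_integral_smul_derivValue hΦ hK hint
  have hT : HasFTaylorSeriesUpTo ∞ (fun t => ∫ p, K p * Φ p t ∂μ) ψ := by
    refine ⟨fun t => ?_, fun b _ t => hψ b t, fun b _ => ?_⟩
    · let e : DerivValue D 0 →L[ℝ] ℂ := LinearMap.mkContinuous
        { toFun := fun x => ContinuousMultilinearMap.curry0 (G := D) x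
          map_add' := fun _ _ => rfl
          map_smul' := fun _ _ => rfl } 1 fun x => by
        rw [one_mul]
        exact (ContinuousMultilinearMap.curry0_norm (G := D) x).le
      exact (e.integral_comp_comm (integrable_smul_derivValue hΦ hK hint 0 t)).symm
    · exact continuous_iff_continuousAt.2 fun t => (hψ b t).continuousAt
  have hd : ∀ (b : ℕ) (t : D), iteratedFDeriv ℝ b (fun t => ∫ p, K p * Φ p t ∂μ) t
      = ψ t b := fun b t => (hT.eq_iteratedFDeriv (m := b) (mod_cast le_top) t).symm
  have hb : ∀ (a b : ℕ) (t : D),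
      ‖t‖ ^ a * ‖iteratedFDeriv ℝ b (fun t => ∫ p, K p * Φ p t ∂μ) t‖ ≤
        ∫ p, ‖K p‖ * SchwartzMap.seminorm ℂ a b (Φ p) ∂μ := by
    intro a b t
    rw [hd]
    calc ‖t‖ ^ a * ‖∫ p, K p • derivValue b (Φ p) t ∂μ‖
        ≤ ‖t‖ ^ a * ∫ p, ‖K p • derivValue b (Φ p) t‖ ∂μ := by
          gcongr; exact norm_integral_le_integral_norm _
      _ = ∫ p, ‖t‖ ^ a * ‖K p • derivValue b (Φ p) t‖ ∂μ := by
          rw [integral_const_mul]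
      _ ≤ _ := by
          refine integral_mono
            ((integrable_smul_derivValue hΦ hK hint b t).norm.const_mul _) (hint a b)
            fun p => ?_
          simp only [norm_smul]
          rw [mul_left_comm]
          exact mul_le_mul_of_nonneg_left ((Φ p).le_seminorm ℂ a b t) (norm_nonneg _)
  refine ⟨⟨fun t => ∫ p, K p * Φ p t ∂μ, hT.contDiff, fun a b => ⟨_, hb a b⟩⟩, hd,
    fun t => rfl, fun a b => ?_⟩
  refine SchwartzMap.seminorm_le_bound ℂ a b _ (integral_nonneg fun p => ?_) (hb a b)
  exact mul_nonneg (norm_nonneg _) (apply_nonneg _ _)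

/-- Continuous linear functionals commute with integrals of families of Schwartz functions. The
Schwartz space is not a Banach space, so the integral is taken of the pairs `(J Φ(p), u Φ(p))`,
where `J` collects the finitely many weighted derivatives that control `u`: the closure of all pairs
`(J ρ, u ρ)` contains no pair `(0, c)` with `c ≠ 0`. -/
theorem apply_eq_integral_of_eq_integral (hΦ : AEStronglyMeasurable Φ μ)
    (hK : AEStronglyMeasurable K μ)
    (hint : ∀ a b : ℕ, Integrable (fun p => ‖K p‖ * SchwartzMap.seminorm ℂ a b (Φ p)) μ)
    {σ : 𝓢(D, ℂ)} (hσ : ∀ t, σ t = ∫ p, K p * Φ p t ∂μ) (u : 𝓢(D, ℂ) →L[ℂ] ℂ) :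
    Integrable (fun p => K p * u (Φ p)) μ ∧ u σ = ∫ p, K p * u (Φ p) ∂μ := by
  obtain ⟨σ', hσ', hσ'', -⟩ := exists_schwartz_integral hΦ hK hint
  obtain rfl : σ = σ' := by ext t; rw [hσ, hσ'']
  obtain ⟨s, C, hC⟩ : ∃ (s : Finset (ℕ × ℕ)) (C : ℝ), ∀ ρ,
      ‖u ρ‖ ≤ C * (s.sup (schwartzSeminormFamily ℂ D ℂ)) ρ := by
    obtain ⟨s, C, -, h⟩ := Seminorm.bound_of_continuous (schwartz_withSeminorms ℂ D ℂ)
      ((normSeminorm ℂ ℂ).comp u.toLinearMap) (by exact continuous_norm.comp u.continuous)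
    exact ⟨s, C, fun ρ => h ρ⟩
  let B := (i : s) → (D →ᵇ DerivValue D i.1.2)
  let J : 𝓢(D, ℂ) →L[ℂ] B := ContinuousLinearMap.pi fun i => weightedDerivCLM D i.1.1 i.1.2
  have hJ : ∀ ρ, (s.sup (schwartzSeminormFamily ℂ D ℂ)) ρ ≤ ‖J ρ‖ := by
    intro ρ
    refine Seminorm.finset_sup_apply_le (norm_nonneg _) fun i hi => ?_
    exact (seminorm_le_norm_weightedDerivCLM i.1 i.2 ρ).trans (norm_le_pi_norm (J ρ) ⟨i, hi⟩)
  have hJint : Integrable (fun p => K p • J (Φ p)) μ := by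
    refine Integrable.of_eval fun i => ?_
    exact integrable_smul_weightedDerivCLM hΦ hK hint i.1.1 i.1.2
  have hC' : ∀ ρ, ‖u ρ‖ ≤ |C| * ‖J ρ‖ := fun ρ => (hC ρ).trans <|
    mul_le_mul (le_abs_self C) (hJ ρ) (apply_nonneg _ _) (abs_nonneg _)
  have huint : Integrable (fun p => K p * u (Φ p)) μ := by
    refine (hJint.norm.const_mul |C|).mono' (hK.mul (u.continuous.comp_aestronglyMeasurable hΦ))
      (Filter.Eventually.of_forall fun p => ?_)
    rw [norm_mul, norm_smul, mul_left_comm]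
    exact mul_le_mul_of_nonneg_left (hC' _) (norm_nonneg _)
  refine ⟨huint, ?_⟩
  let M : Submodule ℂ (B × ℂ) := (LinearMap.range (J.prod u).toLinearMap).topologicalClosure
  have hM : ∀ z ∈ M, ‖z.2‖ ≤ |C| * ‖z.1‖ := by
    intro z hz
    have hcl : IsClosed {z : B × ℂ | ‖z.2‖ ≤ |C| * ‖z.1‖} :=
      isClosed_le (by fun_prop) (by fun_prop)
    refine closure_minimal ?_ hcl hz
    rintro _ ⟨ρ, rfl⟩
    exact hC' ρ
  have hMcl : IsClosed (M : Set (B × ℂ)) := Submodule.isClosed_topologicalClosure _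
  have hmem : ∀ ρ, (J ρ, u ρ) ∈ M := fun ρ =>
    Submodule.le_topologicalClosure _ ⟨ρ, rfl⟩
  -- the Bochner integral of the pairs stays in the closed subspace `M`
  have hI : (∫ p, K p • J (Φ p) ∂μ, ∫ p, K p * u (Φ p) ∂μ) ∈ M := by
    have : CompleteSpace M := hMcl.completeSpace_coe
    have hmeas : AEStronglyMeasurable (fun p => (⟨(J (Φ p), u (Φ p)), hmem _⟩ : M)) μ := by
      have hc : Continuous (fun ρ => (⟨(J ρ, u ρ), hmem ρ⟩ : M)) :=
        (J.continuous.prodMk u.continuous).subtype_mk _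
      exact hc.comp_aestronglyMeasurable hΦ
    have hpair : Integrable (fun p => (K p • J (Φ p), K p * u (Φ p))) μ := hJint.prodMk huint
    have hMint : Integrable (fun p => K p • (⟨(J (Φ p), u (Φ p)), hmem _⟩ : M)) μ := by
      refine hpair.mono (hK.smul hmeas) (Filter.Eventually.of_forall fun p => le_of_eq rfl)
    have h1 := M.subtypeL.integral_comp_comm hMint
    have h2 : ∫ p, M.subtypeL (K p • (⟨(J (Φ p), u (Φ p)), hmem _⟩ : M)) ∂μ
        = (∫ p, K p • J (Φ p) ∂μ, ∫ p, K p * u (Φ p) ∂μ) := by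
      rw [← integral_pair hJint huint]
      rfl
    rw [← h2, h1]
    exact (∫ p, K p • (⟨(J (Φ p), u (Φ p)), hmem _⟩ : M) ∂μ).2
  have hJσ : ∫ p, K p • J (Φ p) ∂μ = J σ := by
    funext i
    rw [eval_integral fun i => integrable_smul_weightedDerivCLM hΦ hK hint i.1.1 i.1.2]
    ext t : 1
    have h1 := (BoundedContinuousFunction.evalCLM ℂ t).integral_comp_comm
      (integrable_smul_weightedDerivCLM hΦ hK hint i.1.1 i.1.2)
    refine h1.symm.trans ?_
    change ∫ p, K p • (((‖t‖ ^ i.1.1 : ℝ) : ℂ) • derivValue i.1.2 (Φ p) t) ∂μ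
      = ((‖t‖ ^ i.1.1 : ℝ) : ℂ) • derivValue i.1.2 σ t
    have h2 : derivValue i.1.2 σ t = ∫ p, K p • derivValue i.1.2 (Φ p) t ∂μ := hσ' _ t
    rw [h2, ← integral_smul]
    exact integral_congr_ae (Filter.Eventually.of_forall fun p => smul_comm _ _ _)
  have hdiff := hM _ (M.sub_mem hI (hmem σ))
  simp only [Prod.fst_sub, Prod.snd_sub, hJσ, sub_self, norm_zero, mul_zero] at hdiff
  exact (sub_eq_zero.1 (norm_le_zero_iff.1 hdiff)).symm

end SchwartzIntegral

/-! ### Weights on the half-space -/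

/-- The weight `(1/y + y)ᵏ (1 + |x|)ˡ` on the half-space. -/
def weight (k l : ℕ) (p : Rn n × ℝ) : ℝ := (1 / p.2 + p.2) ^ k * (1 + ‖p.1‖) ^ l

theorem two_le_inv_add_self {y : ℝ} (hy : 0 < y) : 2 ≤ 1 / y + y := by
  rw [div_add' _ _ _ hy.ne', le_div_iff₀ hy]
  nlinarith [sq_nonneg (y - 1)]

theorem weight_pos (k l : ℕ) {p : Rn n × ℝ} (hp : 0 < p.2) : 0 < weight k l p := by
  have := two_le_inv_add_self hp
  unfold weight; positivity

theorem weight_mul (k l k' l' : ℕ) (p : Rn n × ℝ) :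
    weight k l p * weight k' l' p = weight (k + k') (l + l') p := by
  unfold weight; ring

theorem measurable_weight (k l : ℕ) : Measurable (weight k l : Rn n × ℝ → ℝ) := by
  unfold weight; fun_prop

theorem halfSpaceMeasure_eq_prod :
    halfSpaceMeasure n = (volume : Measure (Rn n)).prod (volume.restrict (Set.Ioi (0 : ℝ))) := by
  have h : {p : Rn n × ℝ | 0 < p.2} = Set.univ ×ˢ Set.Ioi (0 : ℝ) := by ext p; simp
  rw [halfSpaceMeasure, h, Measure.volume_eq_prod, ← Measure.prod_restrict, Measure.restrict_univ]

theorem measurableSet_halfSpace : MeasurableSet {p : Rn n × ℝ | 0 < p.2} :=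
  measurableSet_lt measurable_const measurable_snd

theorem ae_halfSpace_pos : ∀ᵐ p ∂(halfSpaceMeasure n), 0 < p.2 :=
  ae_restrict_mem measurableSet_halfSpace

theorem integrable_inv_weight :
    Integrable (fun p => (weight 2 (n + 1) p)⁻¹) (halfSpaceMeasure n) := by
  rw [halfSpaceMeasure_eq_prod]
  have h1 : Integrable (fun x : Rn n => ((1 + ‖x‖) ^ (n + 1))⁻¹) := by
    have h := integrable_one_add_norm (E := Rn n) (μ := volume) (r := (n + 1 : ℕ))
      (by simp)
    refine h.congr (Filter.Eventually.of_forall fun x => ?_)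
    simp only
    rw [Real.rpow_neg (by positivity), Real.rpow_natCast]
  have h2 : Integrable (fun y : ℝ => ((1 / y + y) ^ 2)⁻¹) (volume.restrict (Set.Ioi (0 : ℝ))) := by
    refine (integrable_inv_one_add_sq.restrict (s := Set.Ioi (0 : ℝ))).mono'
      (by fun_prop) ?_
    filter_upwards [ae_restrict_mem measurableSet_Ioi] with y hy
    have hy : 0 < y := hy
    rw [Real.norm_of_nonneg (by positivity)]
    refine inv_anti₀ (by positivity) ?_
    have : (1 / y + y) ^ 2 = (1 / y) ^ 2 + 2 + y ^ 2 := by field_simp; ring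
    nlinarith [sq_nonneg (1 / y)]
  refine (h1.mul_prod h2).congr (Filter.Eventually.of_forall fun p => ?_)
  simp only [weight, mul_inv]
  ring

/-- A measurable function on the half-space that decays faster than every weight. -/
structure IsRapid (K : Rn n × ℝ → ℂ) : Prop where
  meas : AEStronglyMeasurable K (halfSpaceMeasure n)
  bound : ∀ k l : ℕ, ∃ C : ℝ, ∀ p : Rn n × ℝ, 0 < p.2 → weight k l p * ‖K p‖ ≤ C

theorem integrable_weight_mul_of_bound {g : Rn n × ℝ → ℝ}
    (hg : AEStronglyMeasurable g (halfSpaceMeasure n)) {k l : ℕ} {C : ℝ}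
    (h : ∀ p : Rn n × ℝ, 0 < p.2 → weight (k + 2) (l + (n + 1)) p * |g p| ≤ C) :
    Integrable (fun p => weight k l p * g p) (halfSpaceMeasure n) := by
  refine (integrable_inv_weight.const_mul C).mono'
    ((measurable_weight k l).aestronglyMeasurable.mul hg) ?_
  filter_upwards [ae_halfSpace_pos] with p hp
  have h1 := h p hp
  have h2 := weight_pos 2 (n + 1) hp
  have h3 := weight_pos k l hp
  rw [← div_eq_mul_inv, le_div_iff₀ h2, norm_mul, Real.norm_of_nonneg h3.le, Real.norm_eq_abs]
  rw [← weight_mul] at h1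
  linarith

/-! ### The test functions `t ↦ φ_y (x - t)` -/

/-- The test function `t ↦ φ_y (x - t)` with which `M_φ^f (x, y)` is formed. -/
def atom (φ : 𝓢(Rn n, ℂ)) (p : Rn n × ℝ) : 𝓢(Rn n, ℂ) := reflectAt (dilate φ p.2) p.1

theorem atom_apply (φ : 𝓢(Rn n, ℂ)) {p : Rn n × ℝ} (hp : 0 < p.2) (t : Rn n) :
    atom φ p t = ((p.2 ^ n)⁻¹ : ℝ) * φ (p.2⁻¹ • (p.1 - t)) := by
  rw [atom, reflectAt_apply, dilate_apply φ hp]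

theorem derivValue_sub (b : ℕ) (f g : 𝓢(Rn n, ℂ)) (t : Rn n) :
    derivValue b (f - g) t = derivValue b f t - derivValue b g t := by
  have h := derivValue_add b (f - g) g t
  rw [sub_add_cancel] at h
  rw [h, add_sub_cancel_right]

theorem derivValue_atom (φ : 𝓢(Rn n, ℂ)) (b : ℕ) {p : Rn n × ℝ} (hp : 0 < p.2) (t : Rn n) :
    derivValue b (atom φ p) t
      = ((p.2 ^ n)⁻¹ * (-p.2⁻¹) ^ b) • derivValue b φ (p.2⁻¹ • (p.1 - t)) := by
  have h1 : (atom φ p : Rn n → ℂ)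
      = fun t => (p.2 ^ n)⁻¹ • (fun s => (fun z => φ ((-p.2⁻¹) • z)) (s - p.1)) t := by
    funext t
    simp only [atom_apply φ hp, Complex.real_smul, neg_smul, ← smul_neg, neg_sub]
  have hφ : ContDiff ℝ b φ := φ.smooth b
  have hc : ContDiff ℝ b (fun s => (fun z => φ ((-p.2⁻¹) • z)) (s - p.1)) := by
    exact hφ.comp ((contDiff_id.sub contDiff_const).const_smul (-p.2⁻¹))
  have h2 : iteratedFDeriv ℝ b (atom φ p) t
      = ((p.2 ^ n)⁻¹ * (-p.2⁻¹) ^ b) • iteratedFDeriv ℝ b φ (p.2⁻¹ • (p.1 - t)) := by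
    rw [h1, iteratedFDeriv_const_smul_apply' hc.contDiffAt, iteratedFDeriv_comp_sub (f := fun z => φ ((-p.2⁻¹) • z)),
      iteratedFDeriv_comp_const_smul _ hφ]
    simp only
    rw [smul_smul, neg_smul, ← smul_neg, neg_sub]
  exact h2

/-- The seminorms of the test functions grow at most like a weight. -/
theorem exists_seminorm_atom_le (φ : 𝓢(Rn n, ℂ)) (a b : ℕ) :
    ∃ C : ℝ, 0 ≤ C ∧ ∀ p : Rn n × ℝ, 0 < p.2 →
      SchwartzMap.seminorm ℂ a b (atom φ p) ≤ C * weight (n + b + a) a p := by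
  set S := (Finset.Iic (a, b)).sup (fun m => SchwartzMap.seminorm ℂ m.1 m.2) φ with hS
  have hS0 : 0 ≤ S := apply_nonneg _ _
  refine ⟨4 ^ a * S, by positivity, fun p hp => ?_⟩
  have hw := weight_pos (n + b + a) a hp
  refine SchwartzMap.seminorm_le_bound ℂ a b _ (by positivity) fun t => ?_
  have hd : ‖iteratedFDeriv ℝ b (atom φ p) t‖
      = (p.2⁻¹) ^ (n + b) * ‖iteratedFDeriv ℝ b φ (p.2⁻¹ • (p.1 - t))‖ := by
    have h1 : ‖derivValue b (atom φ p) t‖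
        = (p.2⁻¹) ^ (n + b) * ‖derivValue b φ (p.2⁻¹ • (p.1 - t))‖ := by
      rw [derivValue_atom φ b hp, norm_smul, norm_mul, norm_pow, norm_neg, norm_inv, norm_inv, norm_pow,
        Real.norm_of_nonneg hp.le, pow_add, inv_pow, inv_pow]
    exact h1
  set s := p.2⁻¹ • (p.1 - t) with hs
  have hts : ‖t‖ ≤ (1 + ‖p.1‖) * (2 * (1 / p.2 + p.2)) * (1 + ‖s‖) := by
    have h1 : t = p.1 - p.2 • s := by
      rw [hs, smul_smul, mul_inv_cancel₀ hp.ne', one_smul]; abel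
    have h2 : ‖t‖ ≤ ‖p.1‖ + p.2 * ‖s‖ := by
      rw [h1]
      refine (norm_sub_le _ _).trans ?_
      rw [norm_smul, Real.norm_of_nonneg hp.le]
    have h3 := two_le_inv_add_self hp
    have h4 : 0 < 1 / p.2 := by positivity
    have h5 : ‖p.1‖ + p.2 * ‖s‖ ≤ (1 + ‖p.1‖) * (1 + p.2) * (1 + ‖s‖) := by
      have : 0 ≤ ‖p.1‖ := norm_nonneg _
      have : 0 ≤ ‖s‖ := norm_nonneg _
      have e : (1 + ‖p.1‖) * (1 + p.2) * (1 + ‖s‖) - (‖p.1‖ + p.2 * ‖s‖)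
          = 1 + p.2 + ‖s‖ + ‖p.1‖ * p.2 + ‖p.1‖ * ‖s‖ + ‖p.1‖ * p.2 * ‖s‖ := by ring
      have : 0 ≤ (1 + ‖p.1‖) * (1 + p.2) * (1 + ‖s‖) - (‖p.1‖ + p.2 * ‖s‖) := by
        rw [e]; positivity
      linarith
    refine h2.trans (h5.trans ?_)
    gcongr
    linarith
  have hsup := SchwartzMap.one_add_le_sup_seminorm_apply (𝕜 := ℂ) (m := (a, b)) (k := a) (n := b)
    le_rfl le_rfl φ s
  have hinv : p.2⁻¹ ≤ 1 / p.2 + p.2 := by rw [one_div]; linarith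
  rw [hd]
  calc ‖t‖ ^ a * ((p.2⁻¹) ^ (n + b) * ‖iteratedFDeriv ℝ b φ s‖)
      ≤ ((1 + ‖p.1‖) * (2 * (1 / p.2 + p.2)) * (1 + ‖s‖)) ^ a
          * ((1 / p.2 + p.2) ^ (n + b) * ‖iteratedFDeriv ℝ b φ s‖) := by
        gcongr
    _ = 2 ^ a * weight (n + b + a) a p * ((1 + ‖s‖) ^ a * ‖iteratedFDeriv ℝ b φ s‖) := by
        unfold weight; rw [mul_pow, mul_pow, mul_pow, pow_add (1 / p.2 + p.2) (n + b) a]; ring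
    _ ≤ 2 ^ a * weight (n + b + a) a p * (2 ^ a * S) := by
        gcongr
    _ = 4 ^ a * S * weight (n + b + a) a p := by
        rw [show (4 : ℝ) = 2 * 2 by norm_num, mul_pow]; ring

theorem continuousAt_derivValue_atom (φ : 𝓢(Rn n, ℂ)) (b : ℕ) {p : Rn n × ℝ} (hp : 0 < p.2)
    (t : Rn n) :
    ContinuousAt (fun z : (Rn n × ℝ) × Rn n => derivValue b (atom φ z.1) z.2) (p, t) := by
  have h : ContinuousAt (fun z : (Rn n × ℝ) × Rn n =>
      ((z.1.2 ^ n)⁻¹ * (-z.1.2⁻¹) ^ b) • derivValue b φ (z.1.2⁻¹ • (z.1.1 - z.2))) (p, t) := by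
    have h1 : ContinuousAt (fun z : (Rn n × ℝ) × Rn n => z.1.2⁻¹) (p, t) :=
      ContinuousAt.inv₀ (by fun_prop) hp.ne'
    have h2 : ContinuousAt (fun z : (Rn n × ℝ) × Rn n => (z.1.2 ^ n)⁻¹) (p, t) :=
      ContinuousAt.inv₀ (by fun_prop) (pow_pos hp n).ne'
    have h3 : ContinuousAt (fun z : (Rn n × ℝ) × Rn n => z.1.2⁻¹ • (z.1.1 - z.2)) (p, t) :=
      h1.smul (by fun_prop)
    exact (h2.mul (h1.neg.pow b)).smul
      ((continuous_derivValue b φ).continuousAt.comp h3)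
  refine h.congr ?_
  have hpos : ∀ᶠ z : (Rn n × ℝ) × Rn n in nhds (p, t), 0 < z.1.2 :=
    (continuous_snd.comp continuous_fst).continuousAt.eventually_const_lt hp
  filter_upwards [hpos] with z hz
  rw [derivValue_atom φ b hz]

/-- The test functions depend continuously on the point of the half-space: their derivatives are
jointly continuous, hence converge uniformly on compact sets, and the seminorm bounds control them
uniformly near infinity. -/
theorem continuousOn_atom (φ : 𝓢(Rn n, ℂ)) : ContinuousOn (atom φ) {p | 0 < p.2} := by
  intro p₀ hp₀
  have hp₀ : 0 < p₀.2 := hp₀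
  refine ContinuousAt.continuousWithinAt ?_
  refine ((schwartz_withSeminorms ℂ (Rn n) ℂ).tendsto_nhds _ _).2 ?_
  rintro ⟨a, b⟩ ε hε
  obtain ⟨C, hC0, hC⟩ := exists_seminorm_atom_le φ (a + 1) b
  set M := C * (weight (n + b + (a + 1)) (a + 1) p₀ + 1) with hM
  have hw0 := weight_pos (n + b + (a + 1)) (a + 1) hp₀
  have hM0 : 0 ≤ M := by positivity
  have hwc : ContinuousAt (weight (n := n) (n + b + (a + 1)) (a + 1)) p₀ := by
    unfold weight
    have h1 : ContinuousAt (fun p : Rn n × ℝ => 1 / p.2) p₀ :=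
      ContinuousAt.div₀ (by fun_prop) (by fun_prop) hp₀.ne'
    exact ((h1.add (by fun_prop)).pow _).mul (by fun_prop)
  have hev1 : ∀ᶠ p in nhds p₀, weight (n + b + (a + 1)) (a + 1) p
      < weight (n + b + (a + 1)) (a + 1) p₀ + 1 := hwc.eventually_lt_const (by linarith)
  have hev2 : ∀ᶠ p : Rn n × ℝ in nhds p₀, 0 < p.2 :=
    continuous_snd.continuousAt.eventually_const_lt hp₀
  have hsem : ∀ p : Rn n × ℝ, 0 < p.2 → weight (n + b + (a + 1)) (a + 1) p
      < weight (n + b + (a + 1)) (a + 1) p₀ + 1 →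
      SchwartzMap.seminorm ℂ (a + 1) b (atom φ p) ≤ M := fun p hp hw =>
    (hC p hp).trans (mul_le_mul_of_nonneg_left hw.le hC0)
  set R := 4 * M / ε + 1 with hR
  have hR0 : 0 < R := by positivity
  have hcpt : ∀ᶠ p in nhds p₀, ∀ t ∈ Metric.closedBall (0 : Rn n) R,
      R ^ a * ‖derivValue b (atom φ p) t - derivValue b (atom φ p₀) t‖ < ε / 2 := by
    refine (isCompact_closedBall (0 : Rn n) R).eventually_forall_of_forall_eventually
      (P := fun p t => R ^ a * ‖derivValue b (atom φ p) t - derivValue b (atom φ p₀) t‖ < ε / 2) ?_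
    intro t _
    have h1 := continuousAt_derivValue_atom φ b hp₀ t
    have h2 : ContinuousAt (fun z : (Rn n × ℝ) × Rn n =>
        R ^ a * ‖derivValue b (atom φ z.1) z.2 - derivValue b (atom φ p₀) z.2‖) (p₀, t) :=
      continuousAt_const.mul (h1.sub
        ((continuous_derivValue b (atom φ p₀)).comp continuous_snd).continuousAt).norm
    exact h2.eventually_lt_const (by simpa using hε)
  filter_upwards [hev1, hev2, hcpt] with p hw hp hK
  refine lt_of_le_of_lt ?_ (half_lt_self hε)
  refine SchwartzMap.seminorm_le_bound ℂ a b _ (by positivity) fun t => ?_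
  have hsub : ‖iteratedFDeriv ℝ b (atom φ p - atom φ p₀ : 𝓢(Rn n, ℂ)) t‖
      = ‖derivValue b (atom φ p) t - derivValue b (atom φ p₀) t‖ :=
    congrArg norm (derivValue_sub b (atom φ p) (atom φ p₀) t)
  rcases le_or_gt ‖t‖ R with ht | ht
  · rw [hsub]
    refine le_trans ?_ (hK t (by simpa using ht)).le
    gcongr
  · have hM1 := ((atom φ p - atom φ p₀).le_seminorm ℂ (a + 1) b t).trans
      ((map_sub_le_add _ _ _).trans (add_le_add (hsem p hp hw) (hsem p₀ hp₀ (by linarith))))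
    rw [pow_succ] at hM1
    set N := ‖t‖ ^ a * ‖iteratedFDeriv ℝ b (atom φ p - atom φ p₀ : 𝓢(Rn n, ℂ)) t‖ with hN
    have hN0 : 0 ≤ N := by positivity
    have h3 : N * R ≤ 2 * M := by
      have h4 : N * ‖t‖ ≤ M + M := by rw [hN]; linarith
      nlinarith
    have h5 : 2 * M ≤ ε / 2 * R := by
      rw [hR, mul_add]
      have : ε / 2 * (4 * M / ε) = 2 * M := by field_simp; ring
      rw [this]; linarith
    exact le_of_mul_le_mul_right (h3.trans h5) hR0

instance : TopologicalSpace.PseudoMetrizableSpace 𝓢(Rn n, ℂ) :=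
  have : (uniformity 𝓢(Rn n, ℂ)).IsCountablyGenerated :=
    IsUniformAddGroup.uniformity_countably_generated
  UniformSpace.pseudoMetrizableSpace

theorem aestronglyMeasurable_atom (φ : 𝓢(Rn n, ℂ)) :
    AEStronglyMeasurable (atom φ) (halfSpaceMeasure n) :=
  (continuousOn_atom φ).aestronglyMeasurable measurableSet_halfSpace

theorem integrable_norm_mul_seminorm_atom (φ : 𝓢(Rn n, ℂ)) {K : Rn n × ℝ → ℂ} (hK : IsRapid K)
    (a b : ℕ) :
    Integrable (fun p => ‖K p‖ * SchwartzMap.seminorm ℂ a b (atom φ p)) (halfSpaceMeasure n) := by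
  obtain ⟨C, hC0, hC⟩ := exists_seminorm_atom_le φ a b
  obtain ⟨C', hC'⟩ := hK.bound (n + b + a + 2) (a + (n + 1))
  have h := (integrable_weight_mul_of_bound hK.meas.norm (k := n + b + a) (l := a)
    (C := C') (by simpa using hC')).const_mul C
  have hc : Continuous (SchwartzMap.seminorm ℂ a b : 𝓢(Rn n, ℂ) → ℝ) :=
    (schwartz_withSeminorms ℂ (Rn n) ℂ).continuous_seminorm (a, b)
  refine h.mono' (hK.meas.norm.mul (hc.comp_aestronglyMeasurable (aestronglyMeasurable_atom φ))) ?_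
  filter_upwards [ae_halfSpace_pos] with p hp
  rw [Real.norm_of_nonneg (mul_nonneg (norm_nonneg _) (apply_nonneg _ _))]
  calc _ ≤ ‖K p‖ * (C * weight (n + b + a) a p) := by gcongr; exact hC p hp
    _ = _ := by ring

/-- Superposition of the test functions `t ↦ φ_y (x - t)` with a rapidly decaying kernel. -/
theorem exists_superposition (φ : 𝓢(Rn n, ℂ)) {K : Rn n × ℝ → ℂ} (hK : IsRapid K) :
    ∃ σ : 𝓢(Rn n, ℂ),
      (∀ u : 𝓢(Rn n, ℂ) →L[ℂ] ℂ, Integrable (fun p => K p * u (atom φ p)) (halfSpaceMeasure n) ∧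
        u σ = ∫ p, K p * u (atom φ p) ∂(halfSpaceMeasure n)) ∧
      ∀ a b : ℕ, SchwartzMap.seminorm ℂ a b σ ≤
        ∫ p, ‖K p‖ * SchwartzMap.seminorm ℂ a b (atom φ p) ∂(halfSpaceMeasure n) := by
  have hint := integrable_norm_mul_seminorm_atom φ hK
  obtain ⟨σ, -, h1, h2⟩ := exists_schwartz_integral (aestronglyMeasurable_atom φ) hK.meas hint
  exact ⟨σ, apply_eq_integral_of_eq_integral (aestronglyMeasurable_atom φ) hK.meas hint h1, h2⟩

/-- `(φ_y (x - ·))^ (ξ) = exp (-2πi x·ξ) φ^(-yξ)`. -/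
theorem fourier_atom (φ : 𝓢(Rn n, ℂ)) {p : Rn n × ℝ} (hp : 0 < p.2) (ξ : Rn n) :
    𝓕 (atom φ p) ξ
      = Complex.exp (-2 * Real.pi * Complex.I * (inner ℝ p.1 ξ : ℝ)) * 𝓕 φ (-(p.2 • ξ)) := by
  obtain ⟨x, y⟩ := p
  have hy : 0 < y := hp
  rw [SchwartzMap.fourier_coe, SchwartzMap.fourier_coe, Real.fourier_eq', Real.fourier_eq']
  let h : Rn n → ℂ := fun s =>
    Complex.exp (↑(-2 * Real.pi * inner ℝ (x - y • s) ξ) * Complex.I) • φ s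
  have h1 : ∀ t : Rn n, Complex.exp (↑(-2 * Real.pi * inner ℝ t ξ) * Complex.I) • atom φ (x, y) t
      = ((y ^ n)⁻¹ : ℝ) • h (y⁻¹ • (x - t)) := by
    intro t
    rw [atom_apply φ hp]
    simp only [h, smul_smul, mul_inv_cancel₀ hy.ne', one_smul, sub_sub_cancel, smul_eq_mul,
      Complex.real_smul]
    ring
  simp_rw [h1]
  rw [integral_smul, integral_sub_left_eq_self (fun t => h (y⁻¹ • t)), Measure.integral_comp_smul]
  simp only [finrank_euclideanSpace, Fintype.card_fin]
  rw [inv_pow, inv_inv, abs_of_pos (pow_pos hy n), smul_smul, inv_mul_cancel₀ (pow_pos hy n).ne',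
    one_smul, ← integral_const_mul]
  refine integral_congr_ae (Filter.Eventually.of_forall fun s => ?_)
  simp only [h, smul_eq_mul, ← mul_assoc, ← Complex.exp_add]
  congr 2
  simp only [inner_sub_left, inner_smul_left, inner_neg_right, inner_smul_right]
  push_cast
  simp
  ring

/-! ### Schwartz functions vanishing to high order at the origin -/

/-- All derivatives of `h` of order less than `N` vanish at the origin. -/
def VanishesToOrder (N : ℕ) (h : 𝓢(Rn n, ℂ)) : Prop :=
  ∀ j < N, iteratedFDeriv ℝ j h 0 = 0

/-- Lower order derivatives of a function vanishing to order `N` are recovered from the `N`-th one by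
repeated use of the mean value inequality on balls. -/
theorem norm_iteratedFDeriv_le_of_vanishesToOrder {N : ℕ} {h : 𝓢(Rn n, ℂ)}
    (hh : VanishesToOrder N h) {j : ℕ} (hj : j ≤ N) (u : Rn n) :
    ‖iteratedFDeriv ℝ j h u‖ ≤ ‖u‖ ^ (N - j) * SchwartzMap.seminorm ℂ 0 N h := by
  suffices H : ∀ m ≤ N, ∀ u : Rn n, ‖iteratedFDeriv ℝ (N - m) h u‖
      ≤ ‖u‖ ^ m * SchwartzMap.seminorm ℂ 0 N h by
    have := H (N - j) (Nat.sub_le _ _) u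
    rwa [Nat.sub_sub_self hj] at this
  intro m
  induction m with
  | zero =>
    intro _ u
    simpa using h.norm_iteratedFDeriv_le_seminorm ℂ N u
  | succ m ih =>
    intro hm u
    obtain ⟨i, hi⟩ : ∃ i, N = i + (m + 1) := ⟨N - (m + 1), by omega⟩
    have h1 : N - (m + 1) = i := by omega
    have h2 : N - m = i + 1 := by omega
    rw [h1]
    rw [h2] at ih
    have h0 : iteratedFDeriv ℝ i h 0 = 0 := hh i (by omega)
    have hmv := Convex.norm_image_sub_le_of_norm_hasFDerivWithin_le (𝕜 := ℝ)
      (s := Metric.closedBall (0 : Rn n) ‖u‖) (f := derivValue i h)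
      (f' := fun z => curryDerivValue (Rn n) i (derivValue (i + 1) h z))
      (C := ‖u‖ ^ m * SchwartzMap.seminorm ℂ 0 N h) (x := 0) (y := u)
      (fun z _ => (hasFDerivAt_derivValue i h z).hasFDerivWithinAt)
      (fun z hz => by
        refine (norm_curryDerivValue_le i _).trans ((ih (by omega) z).trans ?_)
        have hz : ‖z‖ ≤ ‖u‖ := by simpa using hz
        have : 0 ≤ SchwartzMap.seminorm ℂ 0 N h := apply_nonneg _ _
        gcongr)
      (convex_closedBall _ _) (by simp) (by simp)
    have h3 : derivValue i h 0 = 0 := h0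
    rw [h3, sub_zero, sub_zero] at hmv
    refine le_trans hmv (le_of_eq ?_)
    rw [pow_succ]; ring

theorem vanishesToOrder_iff_lineDeriv (N : ℕ) (h : 𝓢(Rn n, ℂ)) :
    VanishesToOrder N h ↔ ∀ (j : Fin N) (m : Fin j → Fin n),
      (∂^{fun i => EuclideanSpace.single (m i) (1 : ℝ)} h) 0 = 0 := by
  constructor
  · intro H j m
    rw [SchwartzMap.iteratedLineDerivOp_eq_iteratedFDeriv, H j j.2]
    rfl
  · intro H j hj
    refine ContinuousMultilinearMap.toMultilinearMap_injective ?_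
    refine Module.Basis.ext_multilinear
      (fun _ => (EuclideanSpace.basisFun (Fin n) ℝ).toBasis) fun v => ?_
    have h1 := H ⟨j, hj⟩ v
    rw [SchwartzMap.iteratedLineDerivOp_eq_iteratedFDeriv] at h1
    simpa using h1

/-- Evaluation of a Schwartz function at a point. -/
def evalAt (x : Rn n) : 𝓢(Rn n, ℂ) →L[ℂ] ℂ :=
  (BoundedContinuousFunction.evalCLM ℂ x).comp (SchwartzMap.toBoundedContinuousFunctionCLM ℂ _ ℂ)

theorem evalAt_apply (x : Rn n) (f : 𝓢(Rn n, ℂ)) : evalAt x f = f x := rfl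

/-- The kernel of a continuous linear map to a finite-dimensional space is the range of a continuous
projection. -/
theorem exists_projection_onto_ker {S ι : Type*} [AddCommGroup S] [Module ℂ S]
    [TopologicalSpace S] [IsTopologicalAddGroup S] [ContinuousSMul ℂ S] [Fintype ι]
    (L : S →L[ℂ] (ι → ℂ)) :
    ∃ T : S →L[ℂ] S, (∀ ρ, L (T ρ) = 0) ∧ ∀ ρ, L ρ = 0 → T ρ = ρ := by
  obtain ⟨s, hs⟩ := L.toLinearMap.rangeRestrict.exists_rightInverse_of_surjective
    (LinearMap.range_rangeRestrict _)
  let s' : LinearMap.range L.toLinearMap →L[ℂ] S := ⟨s, s.continuous_of_finiteDimensional⟩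
  have hs' : ∀ v : LinearMap.range L.toLinearMap, L (s' v) = v := fun v =>
    congrArg Subtype.val (LinearMap.congr_fun hs v)
  let R : S →L[ℂ] LinearMap.range L.toLinearMap :=
    L.codRestrict _ fun ρ => LinearMap.mem_range_self L.toLinearMap ρ
  refine ⟨ContinuousLinearMap.id ℂ S - s'.comp R, fun ρ => ?_, fun ρ hρ => ?_⟩
  · simp only [sub_apply, ContinuousLinearMap.id_apply,
      ContinuousLinearMap.comp_apply, map_sub, hs']
    exact sub_self _
  · have : R ρ = 0 := Subtype.ext hρ
    simp [this]

/-- A continuous projection of the Schwartz space onto the functions whose Fourier transform vanishes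
to order `N` at the origin. -/
theorem exists_projection_vanishesToOrder (n N : ℕ) :
    ∃ T : 𝓢(Rn n, ℂ) →L[ℂ] 𝓢(Rn n, ℂ), (∀ ρ, VanishesToOrder N (𝓕 (T ρ))) ∧
      ∀ ρ, VanishesToOrder N (𝓕 ρ) → T ρ = ρ := by
  let L : 𝓢(Rn n, ℂ) →L[ℂ] ((Σ j : Fin N, (Fin j → Fin n)) → ℂ) :=
    ContinuousLinearMap.pi fun i => evalAt 0 ∘L
      (LineDeriv.iteratedLineDerivOpCLM ℂ 𝓢(Rn n, ℂ)
        (fun k => (EuclideanSpace.single (i.2 k) (1 : ℝ) : Rn n))) ∘L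
      (FourierTransform.fourierCLM ℂ 𝓢(Rn n, ℂ))
  have hL : ∀ ρ, L ρ = 0 ↔ VanishesToOrder N (𝓕 ρ) := by
    intro ρ
    rw [vanishesToOrder_iff_lineDeriv]
    constructor
    · intro h j m
      exact congrFun h ⟨j, m⟩
    · intro h
      funext i
      exact h i.1 i.2
  obtain ⟨T, h1, h2⟩ := exists_projection_onto_ker L
  exact ⟨T, fun ρ => (hL _).1 (h1 ρ), fun ρ hρ => h2 ρ ((hL ρ).2 hρ)⟩

theorem seminorm_sum_apply {S ι : Type*} [AddCommGroup S] [Module ℂ S] (s : Finset ι)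
    (q : ι → Seminorm ℂ S) (x : S) : (∑ i ∈ s, q i) x = ∑ i ∈ s, q i x := by
  induction s using Finset.cons_induction with
  | empty => simp
  | cons i s hi ih => rw [Finset.sum_cons, Finset.sum_cons, add_apply, ih]

theorem continuous_seminorm_sum {S ι : Type*} [AddCommGroup S] [Module ℂ S] [TopologicalSpace S]
    (s : Finset ι) {q : ι → Seminorm ℂ S} (hq : ∀ i ∈ s, Continuous (q i)) :
    Continuous (∑ i ∈ s, q i : Seminorm ℂ S) := by
  have : ((∑ i ∈ s, q i : Seminorm ℂ S) : S → ℝ) = fun x => ∑ i ∈ s, q i x :=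
    funext (seminorm_sum_apply s q)
  rw [this]
  exact continuous_finsetSum _ hq

/-! ### The kernel of the synthesis -/

/-- The Schwartz function `θ` is supported in the annulus `a ≤ |v| ≤ b`. -/
structure IsAnnular (θ : 𝓢(Rn n, ℂ)) (a b : ℝ) : Prop where
  pos : 0 < a
  le_one : 1 ≤ b
  supp : ∀ v, θ v ≠ 0 → a ≤ ‖v‖ ∧ ‖v‖ ≤ b

theorem IsAnnular.iteratedFDeriv_eq_zero {θ : 𝓢(Rn n, ℂ)} {a b : ℝ} (hθ : IsAnnular θ a b)
    (j : ℕ) {v : Rn n} (hv : ¬(a ≤ ‖v‖ ∧ ‖v‖ ≤ b)) : iteratedFDeriv ℝ j θ v = 0 := by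
  have hcl : IsClosed {v : Rn n | a ≤ ‖v‖ ∧ ‖v‖ ≤ b} :=
    (isClosed_le continuous_const continuous_norm).inter
      (isClosed_le continuous_norm continuous_const)
  have h1 : tsupport θ ⊆ {v : Rn n | a ≤ ‖v‖ ∧ ‖v‖ ≤ b} :=
    closure_minimal (fun v hv => hθ.supp v hv) hcl
  by_contra h
  exact hv (h1 (support_iteratedFDeriv_subset (𝕜 := ℝ) j h))

/-- The multiplier `ξ ↦ θ (y ξ)`. -/
def dilMul (θ : 𝓢(Rn n, ℂ)) (y : ℝ) : 𝓢(Rn n, ℂ) →L[ℂ] 𝓢(Rn n, ℂ) :=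
  SchwartzMap.smulLeftCLM ℂ (fun ξ => θ (y • ξ))

theorem hasTemperateGrowth_comp_smul (θ : 𝓢(Rn n, ℂ)) (y : ℝ) :
    Function.HasTemperateGrowth (fun ξ : Rn n => θ (y • ξ)) :=
  θ.hasTemperateGrowth.comp (y • ContinuousLinearMap.id ℝ (Rn n)).hasTemperateGrowth

theorem dilMul_apply (θ : 𝓢(Rn n, ℂ)) (y : ℝ) (h : 𝓢(Rn n, ℂ)) (ξ : Rn n) :
    dilMul θ y h ξ = θ (y • ξ) * h ξ := by
  rw [dilMul, SchwartzMap.smulLeftCLM_apply_apply (hasTemperateGrowth_comp_smul θ y), smul_eq_mul]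

/-- One term of the Leibniz formula: on the annulus `a₀ ≤ y |u| ≤ b₀` powers of `1/y` are controlled
by the decay of `h`, and powers of `y` by its vanishing at the origin. -/
theorem annular_term_le {a₀ b₀ : ℝ} (ha₀ : 0 < a₀) (hb₀ : 1 ≤ b₀) (k a b : ℕ) {i j : ℕ}
    (hi : i ≤ b) (hj : j ≤ b) {h : 𝓢(Rn n, ℂ)} (hh : VanishesToOrder (k + 2 * b) h) {y : ℝ}
    (hy : 0 < y) {u : Rn n} (hu : a₀ ≤ y * ‖u‖ ∧ y * ‖u‖ ≤ b₀) :
    (1 / y + y) ^ k * (‖u‖ ^ a * (y ^ i * ‖iteratedFDeriv ℝ j h u‖)) ≤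
      (2 / a₀) ^ k * SchwartzMap.seminorm ℂ (a + k) j h
        + 2 ^ k * b₀ ^ (a + (k + 2 * b)) * SchwartzMap.seminorm ℂ 0 (k + 2 * b) h := by
  have hp1 : 0 ≤ SchwartzMap.seminorm ℂ (a + k) j h := apply_nonneg _ _
  have hp2 : 0 ≤ SchwartzMap.seminorm ℂ 0 (k + 2 * b) h := apply_nonneg _ _
  have hb0 : 0 < b₀ := by linarith
  rcases le_total y 1 with hy1 | hy1
  · have h1 : 1 / y + y ≤ 2 / a₀ * ‖u‖ := by
      have h2 : 1 ≤ 1 / y := by rw [le_div_iff₀ hy]; linarith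
      have h3 : 1 / y ≤ ‖u‖ / a₀ := by
        rw [div_le_div_iff₀ hy ha₀]; linarith [hu.1]
      calc 1 / y + y ≤ 2 * (1 / y) := by linarith
        _ ≤ 2 * (‖u‖ / a₀) := by linarith
        _ = _ := by ring
    have h2 : y ^ i ≤ 1 := pow_le_one₀ hy.le hy1
    calc (1 / y + y) ^ k * (‖u‖ ^ a * (y ^ i * ‖iteratedFDeriv ℝ j h u‖))
        ≤ (2 / a₀ * ‖u‖) ^ k * (‖u‖ ^ a * (1 * ‖iteratedFDeriv ℝ j h u‖)) := by gcongr
      _ = (2 / a₀) ^ k * (‖u‖ ^ (a + k) * ‖iteratedFDeriv ℝ j h u‖) := by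
          rw [mul_pow, pow_add]; ring
      _ ≤ (2 / a₀) ^ k * SchwartzMap.seminorm ℂ (a + k) j h := by
          gcongr; exact h.le_seminorm ℂ (a + k) j u
      _ ≤ _ := by
          have : 0 ≤ 2 ^ k * b₀ ^ (a + (k + 2 * b)) * SchwartzMap.seminorm ℂ 0 (k + 2 * b) h := by
            positivity
          linarith
  · have h1 : 1 / y + y ≤ 2 * y := by
      have h2 : 1 / y ≤ 1 := by rw [div_le_iff₀ hy]; linarith
      linarith
    have hu1 : ‖u‖ ≤ b₀ / y := by rw [le_div_iff₀ hy]; linarith [hu.2]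
    have hu2 : ‖u‖ ≤ b₀ := hu1.trans (div_le_self hb0.le hy1)
    have h3 := norm_iteratedFDeriv_le_of_vanishesToOrder hh (j := j) (by omega) u
    obtain ⟨d, hd⟩ : ∃ d, k + 2 * b - j = k + i + d := ⟨k + 2 * b - j - (k + i), by omega⟩
    have h4 : ‖u‖ ^ (k + 2 * b - j) * y ^ (k + i) ≤ b₀ ^ (k + 2 * b) := by
      calc ‖u‖ ^ (k + 2 * b - j) * y ^ (k + i)
          ≤ (b₀ / y) ^ (k + 2 * b - j) * y ^ (k + 2 * b - j) :=
            mul_le_mul (pow_le_pow_left₀ (norm_nonneg _) hu1 _)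
              (pow_le_pow_right₀ hy1 (by omega)) (by positivity) (by positivity)
        _ = b₀ ^ (k + 2 * b - j) := by rw [← mul_pow, div_mul_cancel₀ _ hy.ne']
        _ ≤ b₀ ^ (k + 2 * b) := pow_le_pow_right₀ hb₀ (Nat.sub_le _ _)
    calc (1 / y + y) ^ k * (‖u‖ ^ a * (y ^ i * ‖iteratedFDeriv ℝ j h u‖))
        ≤ (2 * y) ^ k * (b₀ ^ a * (y ^ i *
            (‖u‖ ^ (k + 2 * b - j) * SchwartzMap.seminorm ℂ 0 (k + 2 * b) h))) := by
          gcongr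
      _ = 2 ^ k * b₀ ^ a * (‖u‖ ^ (k + 2 * b - j) * y ^ (k + i))
            * SchwartzMap.seminorm ℂ 0 (k + 2 * b) h := by
          rw [mul_pow, pow_add y]; ring
      _ ≤ 2 ^ k * b₀ ^ a * b₀ ^ (k + 2 * b) * SchwartzMap.seminorm ℂ 0 (k + 2 * b) h := by
          gcongr
      _ = 2 ^ k * b₀ ^ (a + (k + 2 * b)) * SchwartzMap.seminorm ℂ 0 (k + 2 * b) h := by
          rw [pow_add b₀]; ring
      _ ≤ _ := by
          have : 0 ≤ (2 / a₀) ^ k * SchwartzMap.seminorm ℂ (a + k) j h := by positivity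
          linarith

/-- The multiplier `θ (y ·)` lives on `|ξ| ~ 1/y`, so that vanishing of `h` at the origin gives decay
as `y → ∞`, and rapid decrease of `h` gives decay as `y → 0`. -/
theorem exists_seminorm_dilMul_le {θ : 𝓢(Rn n, ℂ)} {a₀ b₀ : ℝ} (hθ : IsAnnular θ a₀ b₀)
    (k a b : ℕ) : ∃ q : Seminorm ℂ 𝓢(Rn n, ℂ), Continuous q ∧
      ∀ h, VanishesToOrder (k + 2 * b) h → ∀ y : ℝ, 0 < y →
        (1 / y + y) ^ k * SchwartzMap.seminorm ℂ a b (dilMul θ y h) ≤ q h := by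
  have hsc : ∀ i j : ℕ, Continuous (SchwartzMap.seminorm ℂ i j : Seminorm ℂ 𝓢(Rn n, ℂ)) :=
    fun i j => (schwartz_withSeminorms ℂ (Rn n) ℂ).continuous_seminorm (i, j)
  have ha₀ := hθ.pos
  have hb₀ : 0 < b₀ := by linarith [hθ.le_one]
  let c : ℕ → NNReal := fun i =>
    ⟨(b.choose i : ℝ) * SchwartzMap.seminorm ℂ 0 i θ, mul_nonneg (by positivity) (apply_nonneg _ _)⟩
  let c₁ : NNReal := ⟨(2 / a₀) ^ k, by positivity⟩
  let c₂ : NNReal := ⟨2 ^ k * b₀ ^ (a + (k + 2 * b)), by positivity⟩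
  let q : Seminorm ℂ 𝓢(Rn n, ℂ) := ∑ i ∈ Finset.range (b + 1), c i •
    (c₁ • SchwartzMap.seminorm ℂ (a + k) (b - i) + c₂ • SchwartzMap.seminorm ℂ 0 (k + 2 * b))
  have hq : ∀ h, q h = ∑ i ∈ Finset.range (b + 1),
      ((b.choose i : ℝ) * SchwartzMap.seminorm ℂ 0 i θ) *
      ((2 / a₀) ^ k * SchwartzMap.seminorm ℂ (a + k) (b - i) h
        + 2 ^ k * b₀ ^ (a + (k + 2 * b)) * SchwartzMap.seminorm ℂ 0 (k + 2 * b) h) := by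
    intro h
    exact seminorm_sum_apply _ _ h
  refine ⟨q, ?_, fun h hh y hy => ?_⟩
  · have : (q : 𝓢(Rn n, ℂ) → ℝ) = fun h => ∑ i ∈ Finset.range (b + 1),
      ((b.choose i : ℝ) * SchwartzMap.seminorm ℂ 0 i θ) *
      ((2 / a₀) ^ k * SchwartzMap.seminorm ℂ (a + k) (b - i) h
        + 2 ^ k * b₀ ^ (a + (k + 2 * b)) * SchwartzMap.seminorm ℂ 0 (k + 2 * b) h) := funext hq
    rw [this]
    refine continuous_finsetSum _ fun i _ => ?_
    exact continuous_const.mul ((continuous_const.mul (hsc _ _)).add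
      (continuous_const.mul (hsc _ _)))
  have hY : 0 < 1 / y + y := by positivity
  have hq0 : 0 ≤ q h := apply_nonneg _ _
  rw [← le_div_iff₀' (by positivity)]
  refine SchwartzMap.seminorm_le_bound ℂ a b _ (by positivity) fun u => ?_
  rw [le_div_iff₀' (by positivity)]
  have hθd : ∀ i, ‖iteratedFDeriv ℝ i (fun ξ => θ (y • ξ)) u‖
      = y ^ i * ‖iteratedFDeriv ℝ i θ (y • u)‖ := by
    intro i
    rw [iteratedFDeriv_comp_const_smul _ (θ.smooth i), norm_smul, norm_pow,
      Real.norm_of_nonneg hy.le]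
  have hfun : (dilMul θ y h : Rn n → ℂ) = fun ξ => θ (y • ξ) * h ξ := funext (dilMul_apply θ y h)
  have hL := norm_iteratedFDeriv_mul_le (𝕜 := ℝ) (N := b)
    ((θ.smooth b).comp (contDiff_id.const_smul y)) (h.smooth b) u (n := b) le_rfl
  have hL' : ‖iteratedFDeriv ℝ b (dilMul θ y h) u‖ ≤ ∑ i ∈ Finset.range (b + 1),
      (b.choose i : ℝ) * (y ^ i * ‖iteratedFDeriv ℝ i θ (y • u)‖)
        * ‖iteratedFDeriv ℝ (b - i) h u‖ := by
    rw [hfun]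
    refine hL.trans (le_of_eq (Finset.sum_congr rfl fun i _ => ?_))
    rw [← hθd]
    rfl
  calc (1 / y + y) ^ k * (‖u‖ ^ a * ‖iteratedFDeriv ℝ b (dilMul θ y h) u‖)
      ≤ (1 / y + y) ^ k * (‖u‖ ^ a * ∑ i ∈ Finset.range (b + 1),
        (b.choose i : ℝ) * (y ^ i * ‖iteratedFDeriv ℝ i θ (y • u)‖)
        * ‖iteratedFDeriv ℝ (b - i) h u‖) := by gcongr
    _ = ∑ i ∈ Finset.range (b + 1), ((b.choose i : ℝ) * ‖iteratedFDeriv ℝ i θ (y • u)‖) *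
        ((1 / y + y) ^ k * (‖u‖ ^ a * (y ^ i * ‖iteratedFDeriv ℝ (b - i) h u‖))) := by
        rw [Finset.mul_sum, Finset.mul_sum]
        exact Finset.sum_congr rfl fun i _ => by ring
    _ ≤ q h := by
        rw [hq]
        refine Finset.sum_le_sum fun i hi => ?_
        have hp0 : 0 ≤ SchwartzMap.seminorm ℂ 0 i θ := apply_nonneg _ _
        have hp1 : 0 ≤ SchwartzMap.seminorm ℂ (a + k) (b - i) h := apply_nonneg _ _
        have hp2 : 0 ≤ SchwartzMap.seminorm ℂ 0 (k + 2 * b) h := apply_nonneg _ _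
        by_cases hu : a₀ ≤ ‖y • u‖ ∧ ‖y • u‖ ≤ b₀
        · gcongr
          · exact θ.norm_iteratedFDeriv_le_seminorm ℂ i _
          · rw [norm_smul, Real.norm_of_nonneg hy.le] at hu
            exact annular_term_le ha₀ hθ.le_one k a b
              (by have := Finset.mem_range.1 hi; omega) (Nat.sub_le _ _) hh hy hu
        · rw [hθ.iteratedFDeriv_eq_zero i hu, norm_zero, mul_zero, zero_mul]
          positivity

/-- The kernel `K_ρ (x, y) = y⁻¹ 𝓕⁻¹[θ (y ·) 𝓕ρ] (x)` of the synthesis formula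
`ρ = ∫ K_ρ (x, y) φ_y (x - ·) dx dy`. -/
def synthKernel (θ ρ : 𝓢(Rn n, ℂ)) (p : Rn n × ℝ) : ℂ :=
  ((p.2⁻¹ : ℝ) : ℂ) * 𝓕⁻ (dilMul θ p.2 (𝓕 ρ)) p.1

theorem synthKernel_add (θ ρ ρ' : 𝓢(Rn n, ℂ)) (p : Rn n × ℝ) :
    synthKernel θ (ρ + ρ') p = synthKernel θ ρ p + synthKernel θ ρ' p := by
  simp only [synthKernel, FourierTransform.fourier_add, map_add,
    FourierTransform.fourierInv_add, add_apply, mul_add]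

theorem synthKernel_smul (θ ρ : 𝓢(Rn n, ℂ)) (c : ℂ) (p : Rn n × ℝ) :
    synthKernel θ (c • ρ) p = c * synthKernel θ ρ p := by
  simp only [synthKernel, FourierTransform.fourier_smul, map_smul,
    FourierTransform.fourierInv_smul, smul_apply, smul_eq_mul]
  ring

theorem measurable_synthKernel (θ ρ : 𝓢(Rn n, ℂ)) : Measurable (synthKernel θ ρ) := by
  have hc : Continuous (fun p : Rn n × ℝ => 𝓕⁻ (dilMul θ p.2 (𝓕 ρ)) p.1) := by
    have heq : (fun p : Rn n × ℝ => 𝓕⁻ (dilMul θ p.2 (𝓕 ρ)) p.1) = fun p : Rn n × ℝ =>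
        ∫ v, Complex.exp (↑(2 * Real.pi * inner ℝ v p.1) * Complex.I) •
          (θ (p.2 • v) * 𝓕 ρ v) := by
      funext p
      rw [SchwartzMap.fourierInv_coe, Real.fourierInv_eq']
      simp only [dilMul_apply]
    rw [heq]
    refine continuous_of_dominated (bound := fun v => SchwartzMap.seminorm ℂ 0 0 θ * ‖𝓕 ρ v‖)
      (fun p => Continuous.aestronglyMeasurable ?_)
      (fun p => Filter.Eventually.of_forall fun v => ?_)
      ((𝓕 ρ).integrable.norm.const_mul _)
      (Filter.Eventually.of_forall fun v => ?_)
    · have := θ.continuous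
      have := (𝓕 ρ).continuous
      fun_prop
    · rw [norm_smul, Complex.norm_exp_ofReal_mul_I, one_mul, norm_mul]
      gcongr
      exact θ.norm_le_seminorm ℂ _
    · have := θ.continuous
      fun_prop
  have h2 : Measurable (fun p : Rn n × ℝ => ((p.2⁻¹ : ℝ) : ℂ)) := by fun_prop
  exact h2.mul hc.measurable

/-- Against any given weight, the kernel is bounded by a continuous seminorm of `ρ`, as long as `𝓕ρ`
vanishes to sufficiently high order at the origin. -/
theorem exists_weight_mul_synthKernel_le {θ : 𝓢(Rn n, ℂ)} {a₀ b₀ : ℝ} (hθ : IsAnnular θ a₀ b₀)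
    (k l : ℕ) : ∃ (N : ℕ) (q : Seminorm ℂ 𝓢(Rn n, ℂ)), Continuous q ∧
      ∀ ρ, VanishesToOrder N (𝓕 ρ) → ∀ p : Rn n × ℝ, 0 < p.2 →
        weight k l p * ‖synthKernel θ ρ p‖ ≤ q ρ := by
  -- a continuous seminorm on the Fourier side controls the decay of the inverse transform
  let S : Seminorm ℂ 𝓢(Rn n, ℂ) :=
    (Finset.Iic (l, 0)).sup (fun m : ℕ × ℕ => SchwartzMap.seminorm ℂ m.1 m.2)
  have hS : Continuous S := Seminorm.continuous_of_le (continuous_seminorm_sum _ fun m _ =>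
    (schwartz_withSeminorms ℂ (Rn n) ℂ).continuous_seminorm m) (Seminorm.finset_sup_le_sum _ _)
  obtain ⟨s, C, -, hsC⟩ := Seminorm.bound_of_continuous (schwartz_withSeminorms ℂ (Rn n) ℂ)
    (S.comp (FourierTransform.fourierInvCLM ℂ 𝓢(Rn n, ℂ)).toLinearMap)
    (hS.comp (FourierTransform.fourierInvCLM ℂ 𝓢(Rn n, ℂ)).continuous)
  choose Q hQc hQ using fun m : ℕ × ℕ => exists_seminorm_dilMul_le hθ (k + 1) m.1 m.2
  let q₀ : Seminorm ℂ 𝓢(Rn n, ℂ) := ((2 : NNReal) ^ l * C) • ∑ m ∈ s, Q m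
  have hq₀ : ∀ h, q₀ h = 2 ^ l * C * ∑ m ∈ s, Q m h := by
    intro h
    rw [← seminorm_sum_apply]
    rfl
  refine ⟨s.sup fun m => k + 1 + 2 * m.2,
    q₀.comp (FourierTransform.fourierCLM ℂ 𝓢(Rn n, ℂ)).toLinearMap, ?_, fun ρ hρ p hp => ?_⟩
  · have h1 : Continuous q₀ := by
      rw [show (q₀ : 𝓢(Rn n, ℂ) → ℝ) = fun h => 2 ^ l * C * ∑ m ∈ s, Q m h from funext hq₀]
      exact continuous_const.mul (continuous_finsetSum _ fun m _ => hQc m)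
    exact h1.comp (FourierTransform.fourierCLM ℂ 𝓢(Rn n, ℂ)).continuous
  set h := 𝓕 ρ with hh
  set g := dilMul θ p.2 h with hg
  have h1 : (1 + ‖p.1‖) ^ l * ‖𝓕⁻ g p.1‖ ≤ 2 ^ l * C * ∑ m ∈ s, SchwartzMap.seminorm ℂ m.1 m.2 g := by
    have h2 := SchwartzMap.one_add_le_sup_seminorm_apply (𝕜 := ℂ) (m := (l, 0)) (k := l) (n := 0)
      le_rfl le_rfl (𝓕⁻ g) p.1
    rw [norm_iteratedFDeriv_zero] at h2
    refine h2.trans ?_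
    rw [mul_assoc]
    gcongr
    refine (hsC g).trans ?_
    change C * (s.sup (schwartzSeminormFamily ℂ (Rn n) ℂ)) g ≤ _
    gcongr
    refine Seminorm.finset_sup_apply_le (Finset.sum_nonneg fun m _ => apply_nonneg _ _) fun m hm => ?_
    exact Finset.single_le_sum (f := fun m : ℕ × ℕ => SchwartzMap.seminorm ℂ m.1 m.2 g)
      (fun m _ => apply_nonneg _ _) hm
  have hY := two_le_inv_add_self hp
  have hinv : p.2⁻¹ ≤ 1 / p.2 + p.2 := by rw [one_div]; linarith
  have hC0 : (0 : ℝ) ≤ C := C.2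
  change weight k l p * ‖synthKernel θ ρ p‖ ≤ q₀ h
  rw [hq₀, synthKernel, norm_mul, Complex.norm_real, Real.norm_of_nonneg (by positivity), weight]
  calc (1 / p.2 + p.2) ^ k * (1 + ‖p.1‖) ^ l * (p.2⁻¹ * ‖𝓕⁻ g p.1‖)
      ≤ (1 / p.2 + p.2) ^ k * (1 + ‖p.1‖) ^ l * ((1 / p.2 + p.2) * ‖𝓕⁻ g p.1‖) := by gcongr
    _ = (1 / p.2 + p.2) ^ (k + 1) * ((1 + ‖p.1‖) ^ l * ‖𝓕⁻ g p.1‖) := by ring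
    _ ≤ (1 / p.2 + p.2) ^ (k + 1) *
          (2 ^ l * C * ∑ m ∈ s, SchwartzMap.seminorm ℂ m.1 m.2 g) := by gcongr
    _ = 2 ^ l * C * ∑ m ∈ s, (1 / p.2 + p.2) ^ (k + 1) * SchwartzMap.seminorm ℂ m.1 m.2 g := by
        rw [← Finset.mul_sum]; ring
    _ ≤ 2 ^ l * C * ∑ m ∈ s, Q m h := by
        gcongr with m hm
        exact hQ m h (fun j hj => hρ j (hj.trans_le
          (Finset.le_sup (f := fun m : ℕ × ℕ => k + 1 + 2 * m.2) hm))) p.2 hp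

theorem isRapid_synthKernel {θ : 𝓢(Rn n, ℂ)} {a₀ b₀ : ℝ} (hθ : IsAnnular θ a₀ b₀)
    {σ : 𝓢(Rn n, ℂ)} (hσ : ∀ N, VanishesToOrder N (𝓕 σ)) : IsRapid (synthKernel θ σ) := by
  refine ⟨(measurable_synthKernel θ σ).aestronglyMeasurable, fun k l => ?_⟩
  obtain ⟨N, q, -, hq⟩ := exists_weight_mul_synthKernel_le hθ k l
  exact ⟨q σ, hq σ (hσ N)⟩

/-! ### A reconstruction function for a non-degenerate test function -/

open scoped ContDiff Convolution

/-- The substitution `y = eˢ`. -/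
theorem integral_Ioi_inv_mul_eq_integral_exp (h : ℝ → ℂ) :
    ∫ y in Set.Ioi (0 : ℝ), ((y⁻¹ : ℝ) : ℂ) * h y = ∫ s : ℝ, h (Real.exp s) := by
  have h1 := integral_image_eq_integral_abs_deriv_smul (s := Set.univ) (f := Real.exp)
    (f' := Real.exp) MeasurableSet.univ
    (fun x _ => (Real.hasDerivAt_exp x).hasDerivWithinAt) Real.exp_injective.injOn
    (fun y => ((y⁻¹ : ℝ) : ℂ) * h y)
  rw [Set.image_univ, Real.range_exp, Measure.restrict_univ] at h1
  rw [h1]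
  refine integral_congr_ae (Filter.Eventually.of_forall fun s => ?_)
  simp only
  rw [abs_of_pos (Real.exp_pos s), Complex.real_smul, ← mul_assoc, ← Complex.ofReal_mul,
    mul_inv_cancel₀ (Real.exp_pos s).ne', Complex.ofReal_one, one_mul]

/-- By compactness of the sphere the radii at which `ψ` does not vanish can be chosen in a fixed
compact subinterval of `(0, ∞)`. -/
theorem exists_uniform_radius {ψ : Rn n → ℂ} (hψ : Continuous ψ)
    (h : ∀ e : Rn n, ‖e‖ = 1 → ∃ r : ℝ, 0 ≤ r ∧ ψ (r • e) ≠ 0) :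
    ∃ M : ℝ, 1 < M ∧ ∀ e : Rn n, ‖e‖ = 1 → ∃ r : ℝ, M⁻¹ < r ∧ r < M ∧ ψ (-(r • e)) ≠ 0 := by
  let U : ℕ → Set (Rn n) := fun m =>
    {e | ∃ r : ℝ, ((m : ℝ) + 2)⁻¹ < r ∧ r < (m : ℝ) + 2 ∧ ψ (-(r • e)) ≠ 0}
  have hUo : ∀ m, IsOpen (U m) := by
    intro m
    have : U m = ⋃ r ∈ Set.Ioo ((m : ℝ) + 2)⁻¹ ((m : ℝ) + 2), {e | ψ (-(r • e)) ≠ 0} := by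
      ext e; simp [U, and_assoc]
    rw [this]
    refine isOpen_biUnion fun r _ => ?_
    exact isOpen_ne_fun (by fun_prop) continuous_const
  have hUm : Monotone U := by
    intro m m' hm e
    rintro ⟨r, h1, h2, h3⟩
    have hm' : (m : ℝ) ≤ m' := by exact_mod_cast hm
    refine ⟨r, lt_of_le_of_lt ?_ h1, by linarith, h3⟩
    gcongr
  have hcov : Metric.sphere (0 : Rn n) 1 ⊆ ⋃ m, U m := by
    intro e he
    have he : ‖-e‖ = 1 := by simpa using he
    obtain ⟨r, hr0, hr⟩ := h (-e) he
    have hop : IsOpen {s : ℝ | ψ (s • (-e)) ≠ 0} := isOpen_ne_fun (by fun_prop) continuous_const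
    have hev : ∀ᶠ s in nhdsWithin r (Set.Ioi r), ψ (s • (-e)) ≠ 0 :=
      nhdsWithin_le_nhds (hop.mem_nhds hr)
    obtain ⟨s, hs, hrs⟩ := (hev.and self_mem_nhdsWithin).exists
    have hs0 : 0 < s := lt_of_le_of_lt hr0 hrs
    obtain ⟨m, hm⟩ := exists_nat_gt (max s s⁻¹)
    have hm1 := (le_max_left s s⁻¹).trans_lt hm
    have hm2 := (le_max_right s s⁻¹).trans_lt hm
    refine Set.mem_iUnion.2 ⟨m, s, ?_, by linarith, by simpa using hs⟩
    rw [inv_lt_comm₀ (by positivity) hs0]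
    linarith
  obtain ⟨m, hm⟩ := (isCompact_sphere (0 : Rn n) 1).elim_directed_cover U hUo hcov
    hUm.directed_le
  refine ⟨(m : ℝ) + 2, by have : (0 : ℝ) ≤ m := by positivity
                          linarith, fun e he => hm (by simpa using he)⟩

/-- `∫ A (eˢ u) ds`, that is `∫ A (y u) dy / y` over `y > 0`. -/
def radialIntegral (A : Rn n → ℝ) (u : Rn n) : ℝ := ∫ s : ℝ, A (Real.exp s • u)

theorem radialIntegral_smul (A : Rn n → ℝ) (u : Rn n) {y : ℝ} (hy : 0 < y) :
    radialIntegral A (y • u) = radialIntegral A u := by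
  unfold radialIntegral
  rw [← integral_add_right_eq_self (fun s => A (Real.exp s • u)) (Real.log y)]
  refine integral_congr_ae (Filter.Eventually.of_forall fun s => ?_)
  simp only
  rw [Real.exp_add, Real.exp_log hy, smul_smul]

theorem exp_mem_of_annular {A : Rn n → ℝ} {a b : ℝ} (ha : 0 < a)
    (hA : ∀ v, A v ≠ 0 → a ≤ ‖v‖ ∧ ‖v‖ ≤ b) {a₁ b₁ : ℝ} (ha₁ : 0 < a₁) {u : Rn n}
    (h1 : a₁ ≤ ‖u‖) (h2 : ‖u‖ ≤ b₁) {s : ℝ} (hs : A (Real.exp s • u) ≠ 0) :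
    s ∈ Set.Icc (Real.log (a / b₁)) (Real.log (b / a₁)) := by
  obtain ⟨h3, h4⟩ := hA _ hs
  rw [norm_smul, Real.norm_of_nonneg (Real.exp_pos s).le] at h3 h4
  have hb₁ : 0 < b₁ := by linarith
  have he := Real.exp_pos s
  have hb : 0 < b := by
    have : 0 < Real.exp s * ‖u‖ := mul_pos he (by linarith)
    linarith
  constructor
  · rw [Real.log_le_iff_le_exp (by positivity), div_le_iff₀ hb₁]
    nlinarith
  · rw [Real.le_log_iff_exp_le (by positivity), le_div_iff₀ ha₁]
    nlinarith

theorem contDiffAt_radialIntegral {A : Rn n → ℝ} (hAs : ContDiff ℝ ∞ A) {a b : ℝ} (ha : 0 < a)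
    (hA : ∀ v, A v ≠ 0 → a ≤ ‖v‖ ∧ ‖v‖ ≤ b) {u : Rn n} (hu : u ≠ 0) :
    ContDiffAt ℝ ∞ (radialIntegral A) u := by
  have hu0 : 0 < ‖u‖ := norm_pos_iff.2 hu
  let s : Set (Rn n) := {v | ‖u‖ / 2 < ‖v‖ ∧ ‖v‖ < 2 * ‖u‖}
  have hs : IsOpen s := (isOpen_lt continuous_const continuous_norm).inter
    (isOpen_lt continuous_norm continuous_const)
  have hus : u ∈ s := ⟨by linarith, by linarith⟩
  have hg : ContDiffOn ℝ ∞ (Function.uncurry fun (v : Rn n) (t : ℝ) => A (Real.exp t • v))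
      (s ×ˢ Set.univ) := by
    refine ContDiff.contDiffOn ?_
    exact hAs.comp ((Real.contDiff_exp.comp contDiff_snd).smul contDiff_fst)
  have hconv := contDiffOn_convolution_right_with_param (𝕜 := ℝ) (μ := volume)
    (f := fun _ : ℝ => (1 : ℝ)) (n := ⊤) (ContinuousLinearMap.mul ℝ ℝ) hs
    (isCompact_Icc (a := Real.log (a / (2 * ‖u‖))) (b := Real.log (b / (‖u‖ / 2))))
    (fun v t hv ht => by
      by_contra h
      exact ht (exp_mem_of_annular ha hA (by linarith) hv.1.le hv.2.le h))
    (locallyIntegrable_const 1) hg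
  have h2 : ContDiffOn ℝ ∞ (radialIntegral A) s := by
    have h3 := hconv.comp (f := fun v : Rn n => (v, (0 : ℝ))) (s := s) (t := s ×ˢ Set.univ)
      (contDiff_id.prodMk contDiff_const).contDiffOn (fun v hv => ⟨hv, Set.mem_univ _⟩)
    refine h3.congr fun v _ => ?_
    simp only [Function.comp_apply, MeasureTheory.convolution_def, ContinuousLinearMap.mul_apply',
      one_mul, zero_sub]
    exact (integral_neg_eq_self (fun t => A (Real.exp t • v)) volume).symm
  exact h2.contDiffAt (hs.mem_nhds hus)

theorem radialIntegral_pos {A : Rn n → ℝ} (hAc : Continuous A) {a b : ℝ} (ha : 0 < a)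
    (hA : ∀ v, A v ≠ 0 → a ≤ ‖v‖ ∧ ‖v‖ ≤ b) (hA0 : ∀ v, 0 ≤ A v) {u : Rn n} (hu : u ≠ 0)
    (hpos : ∃ r : ℝ, 0 < r ∧ A (r • u) ≠ 0) : 0 < radialIntegral A u := by
  have hu0 : 0 < ‖u‖ := norm_pos_iff.2 hu
  obtain ⟨r, hr, hAr⟩ := hpos
  refine Continuous.integral_pos_of_hasCompactSupport_nonneg_nonzero (x := Real.log r)
    (hAc.comp (Real.continuous_exp.smul continuous_const)) ?_ (fun s => hA0 _) ?_
  · exact HasCompactSupport.of_support_subset_isCompact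
      (isCompact_Icc (a := Real.log (a / ‖u‖)) (b := Real.log (b / ‖u‖)))
      fun s hs => exp_mem_of_annular ha hA hu0 le_rfl le_rfl hs
  · rwa [Real.exp_log hr]

/-- For every `ψ` that vanishes identically on no ray there is a smooth function `θ` with compact
support away from the origin such that `∫ ψ (-y ξ) θ (y ξ) dy / y = 1` for all `ξ ≠ 0`. It is
obtained by normalizing a cut-off of the complex conjugate of `ψ (- ·)`. -/
theorem exists_reconstruction (ψ : 𝓢(Rn n, ℂ))
    (h : ∀ e : Rn n, ‖e‖ = 1 → ∃ r : ℝ, 0 ≤ r ∧ ψ (r • e) ≠ 0) :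
    ∃ (θ : 𝓢(Rn n, ℂ)) (a b : ℝ), IsAnnular θ a b ∧ ∀ ξ : Rn n, ξ ≠ 0 →
      ∫ y in Set.Ioi (0 : ℝ), ((y⁻¹ : ℝ) : ℂ) * (ψ (-(y • ξ)) * θ (y • ξ)) = 1 := by
  obtain ⟨M, hM1, hM⟩ := exists_uniform_radius ψ.continuous h
  have hM0 : 0 < M := by linarith
  set α := (M⁻¹) ^ 2 with hα
  set β := M ^ 2 with hβ
  have hα0 : 0 < α := by positivity
  have hαβ : α < β := by
    have h1 : M⁻¹ < 1 := inv_lt_one_of_one_lt₀ hM1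
    have h2 : α < 1 := by rw [hα]; exact pow_lt_one₀ (by positivity) h1 two_ne_zero
    have h3 : 1 < β := by rw [hβ]; exact one_lt_pow₀ hM1 two_ne_zero
    linarith
  -- a bump function equal to `1` on `[α, β]` with support in `[α / 2, β + α / 2]`
  let f : ContDiffBump ((α + β) / 2) :=
    ⟨(β - α) / 2, (β - α) / 2 + α / 2, by linarith, by linarith⟩
  have hf1 : ∀ s, α < s → s < β → f s = 1 := by
    intro s h1 h2
    refine f.one_of_mem_closedBall ?_
    rw [Metric.mem_closedBall, Real.dist_eq, abs_le]
    constructor <;> simp only [f] <;> linarith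
  have hf0 : ∀ s, f s ≠ 0 → α / 2 < s ∧ s < β + α / 2 := by
    intro s hs
    have h1 : s ∈ Function.support f := hs
    rw [f.support_eq, Metric.mem_ball, Real.dist_eq, abs_lt] at h1
    simp only [f] at h1
    constructor <;> linarith [h1.1, h1.2]
  let A : Rn n → ℝ := fun v => ‖ψ (-v)‖ ^ 2 * f (‖v‖ ^ 2)
  have hψs : ContDiff ℝ ∞ (fun v : Rn n => ψ (-v)) := (ψ.smooth ⊤).comp contDiff_neg
  have hfs : ContDiff ℝ ∞ (fun v : Rn n => f (‖v‖ ^ 2)) :=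
    f.contDiff.comp (contDiff_norm_sq ℝ)
  have hAs : ContDiff ℝ ∞ A := ((contDiff_norm_sq ℝ).comp hψs).mul hfs
  have hsupp : ∀ v : Rn n, f (‖v‖ ^ 2) ≠ 0 → M⁻¹ / 2 ≤ ‖v‖ ∧ ‖v‖ ≤ 2 * M := by
    intro v hv
    obtain ⟨h1, h2⟩ := hf0 _ hv
    have hv0 := norm_nonneg v
    constructor
    · refine le_of_sq_le_sq ?_ hv0
      rw [div_pow]
      linarith
    · refine le_of_sq_le_sq ?_ (by positivity)
      rw [mul_pow]
      linarith
  have ha0 : 0 < M⁻¹ / 2 := by positivity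
  have hAsupp : ∀ v : Rn n, A v ≠ 0 → M⁻¹ / 2 ≤ ‖v‖ ∧ ‖v‖ ≤ 2 * M := fun v hv =>
    hsupp v (right_ne_zero_of_mul hv)
  have hA0 : ∀ v, 0 ≤ A v := fun v => mul_nonneg (by positivity) f.nonneg
  set c : Rn n → ℝ := radialIntegral A with hc
  have hcpos : ∀ u : Rn n, u ≠ 0 → 0 < c u := by
    intro u hu
    refine radialIntegral_pos hAs.continuous ha0 hAsupp hA0 hu ?_
    have hu0 : 0 < ‖u‖ := norm_pos_iff.2 hu
    obtain ⟨r, h1, h2, h3⟩ := hM (‖u‖⁻¹ • u) (by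
      rw [norm_smul, norm_inv, norm_norm, inv_mul_cancel₀ hu0.ne'])
    have hr : 0 < r := lt_trans (by positivity) h1
    refine ⟨r * ‖u‖⁻¹, by positivity, ?_⟩
    rw [smul_smul] at h3
    have h4 : ‖(r * ‖u‖⁻¹) • u‖ = r := by
      rw [norm_smul, norm_mul, norm_inv, norm_norm, Real.norm_of_nonneg hr.le, mul_assoc,
        inv_mul_cancel₀ hu0.ne', mul_one]
    simp only [A]
    rw [h4, hf1 (r ^ 2) (by rw [hα]; gcongr) (by rw [hβ]; gcongr), mul_one]
    exact pow_ne_zero 2 (norm_ne_zero_iff.2 h3)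
  let θ₀ : Rn n → ℂ := fun v =>
    (starRingEnd ℂ) (ψ (-v)) * ((f (‖v‖ ^ 2) * (c v)⁻¹ : ℝ) : ℂ)
  have hθsupp : ∀ v : Rn n, θ₀ v ≠ 0 → M⁻¹ / 2 ≤ ‖v‖ ∧ ‖v‖ ≤ 2 * M := by
    intro v hv
    refine hsupp v fun h0 => hv ?_
    simp [θ₀, h0]
  have hθs : ContDiff ℝ ∞ θ₀ := by
    rw [contDiff_iff_contDiffAt]
    intro v
    by_cases hv : v = 0
    · subst hv
      have hev : θ₀ =ᶠ[nhds 0] fun _ => 0 := by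
        filter_upwards [Metric.ball_mem_nhds (0 : Rn n) ha0] with w hw
        by_contra hne
        have := (hθsupp w hne).1
        rw [mem_ball_zero_iff] at hw
        linarith
      exact contDiffAt_const.congr_of_eventuallyEq hev
    · have h1 : ContDiffAt ℝ ∞ c v := contDiffAt_radialIntegral hAs ha0 hAsupp hv
      have h2 : ContDiffAt ℝ ∞ (fun v => f (‖v‖ ^ 2) * (c v)⁻¹) v :=
        hfs.contDiffAt.mul (h1.inv (hcpos v hv).ne')
      have h3 : ContDiffAt ℝ ∞ (fun v => ((f (‖v‖ ^ 2) * (c v)⁻¹ : ℝ) : ℂ)) v :=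
        Complex.ofRealCLM.contDiff.contDiffAt.comp v h2
      have h4 : ContDiffAt ℝ ∞ (fun v : Rn n => (starRingEnd ℂ) (ψ (-v))) v :=
        (Complex.conjCLE.contDiff.comp hψs).contDiffAt
      exact h4.mul h3
  have hθc : HasCompactSupport θ₀ :=
    HasCompactSupport.of_support_subset_isCompact (isCompact_closedBall (0 : Rn n) (2 * M))
      fun v hv => by simpa using (hθsupp v hv).2
  refine ⟨hθc.toSchwartzMap hθs, M⁻¹ / 2, 2 * M, ⟨ha0, by linarith, hθsupp⟩, fun ξ hξ => ?_⟩
  rw [integral_Ioi_inv_mul_eq_integral_exp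
    (fun y => ψ (-(y • ξ)) * hθc.toSchwartzMap hθs (y • ξ))]
  have hval : ∀ s : ℝ, ψ (-(Real.exp s • ξ)) * hθc.toSchwartzMap hθs (Real.exp s • ξ)
      = ((A (Real.exp s • ξ) * (c ξ)⁻¹ : ℝ) : ℂ) := by
    intro s
    change ψ (-(Real.exp s • ξ)) * θ₀ (Real.exp s • ξ) = _
    simp only [θ₀, A]
    rw [hc, radialIntegral_smul A ξ (Real.exp_pos s), ← mul_assoc, Complex.mul_conj,
      Complex.normSq_eq_norm_sq]
    push_cast
    ring
  simp_rw [hval]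
  rw [integral_complex_ofReal, integral_mul_const]
  have : (∫ s : ℝ, A (Real.exp s • ξ)) = c ξ := rfl
  rw [this, mul_inv_cancel₀ (hcpos ξ hξ).ne', Complex.ofReal_one]

/-! ### A function on the half-line with prescribed moments -/

/-- A superposition of modulated Gaussians. The modulation by `exp (2 π i m (t - q))`, integrated
over `m ∈ [0, 1]`, extracts one exponential moment, the factor `exp (2 π² m²)` compensating the
size of the Gaussian integral at the complex shift `2 π i m`. -/
def gaussianPacket (q : ℕ) (t : ℝ) : ℂ :=
  ∫ m in (0 : ℝ)..1, Complex.exp (-(1 / 2) * t ^ 2 + (2 * Real.pi * Complex.I * m) * t +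
    (2 * Real.pi ^ 2 * m ^ 2 - 2 * Real.pi * Complex.I * m * q))

theorem continuous_gaussianPacket (q : ℕ) : Continuous (gaussianPacket q) := by
  unfold gaussianPacket
  refine intervalIntegral.continuous_parametric_intervalIntegral_of_continuous' ?_ 0 1
  unfold Function.uncurry
  fun_prop

theorem norm_gaussianPacket_le (q : ℕ) (t : ℝ) :
    ‖gaussianPacket q t‖ ≤ Real.exp (2 * Real.pi ^ 2) * Real.exp (-(t ^ 2) / 2) := by
  unfold gaussianPacket
  refine (intervalIntegral.norm_integral_le_of_norm_le_const
    (C := Real.exp (2 * Real.pi ^ 2) * Real.exp (-(t ^ 2) / 2)) fun m hm => ?_).trans_eq (by simp)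
  rw [Set.uIoc_of_le zero_le_one] at hm
  rw [Complex.norm_exp, ← Real.exp_add]
  have h2 : m ^ 2 ≤ 1 := by nlinarith [hm.1, hm.2]
  have : (-(1 / 2) * (t : ℂ) ^ 2 + (2 * Real.pi * Complex.I * m) * t +
    (2 * Real.pi ^ 2 * m ^ 2 - 2 * Real.pi * Complex.I * m * q)).re
      = -(t ^ 2) / 2 + 2 * Real.pi ^ 2 * m ^ 2 := by
    have : (-(1 / 2) * (t : ℂ) ^ 2 + (2 * Real.pi * Complex.I * m) * t +
      (2 * Real.pi ^ 2 * m ^ 2 - 2 * Real.pi * Complex.I * m * q))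
      = ((-(t ^ 2) / 2 + 2 * Real.pi ^ 2 * m ^ 2 : ℝ) : ℂ)
        + ((2 * Real.pi * m * t - 2 * Real.pi * m * q : ℝ) : ℂ) * Complex.I := by
      push_cast; ring
    rw [this, Complex.add_re, Complex.re_ofReal_mul, Complex.ofReal_re]
    simp
  rw [this]
  gcongr Real.exp ?_
  nlinarith [mul_le_mul_of_nonneg_left h2 (by positivity : 0 ≤ 2 * Real.pi ^ 2)]

theorem integral_exp_two_pi_mul (j q : ℕ) :
    ∫ m in (0 : ℝ)..1, Complex.exp ((2 * Real.pi * Complex.I * ((j : ℂ) - q)) * m)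
      = if j = q then 1 else 0 := by
  split_ifs with h
  · subst h; simp
  · have hc : (2 * Real.pi * Complex.I * ((j : ℂ) - q)) ≠ 0 :=
      mul_ne_zero Complex.two_pi_I_ne_zero (sub_ne_zero.2 (by exact_mod_cast h))
    rw [integral_exp_mul_complex hc]
    have : (2 * Real.pi * Complex.I * ((j : ℂ) - q)) * (1 : ℝ)
        = ((j - q : ℤ) : ℂ) * (2 * Real.pi * Complex.I) := by push_cast; ring
    rw [this, Complex.exp_int_mul_two_pi_mul_I]
    simp

theorem integral_gaussianPacket_mul_exp (q j : ℕ) :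
    ∫ t, gaussianPacket q t * (Real.exp t : ℂ) ^ j
      = if j = q then (Real.pi / (1 / 2) : ℂ) ^ (1 / 2 : ℂ) * Complex.exp (q ^ 2 / 2) else 0 := by
  have h1 : ∀ t : ℝ, gaussianPacket q t * (Real.exp t : ℂ) ^ j
      = ∫ m in (0 : ℝ)..1, Complex.exp (-(1 / 2) * t ^ 2 + (j + 2 * Real.pi * Complex.I * m) * t +
        (2 * Real.pi ^ 2 * m ^ 2 - 2 * Real.pi * Complex.I * m * q)) := by
    intro t
    rw [gaussianPacket, ← intervalIntegral.integral_mul_const]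
    congr 1
    ext m
    rw [Complex.ofReal_exp, ← Complex.exp_nat_mul, ← Complex.exp_add]
    congr 1
    ring
  simp_rw [h1, intervalIntegral.integral_of_le zero_le_one]
  rw [integral_integral_swap]
  · have h2 : ∀ m : ℝ, ∫ t : ℝ, Complex.exp (-(1 / 2) * t ^ 2
        + (j + 2 * Real.pi * Complex.I * m) * t
        + (2 * Real.pi ^ 2 * m ^ 2 - 2 * Real.pi * Complex.I * m * q))
        = ((Real.pi / (1 / 2) : ℂ) ^ (1 / 2 : ℂ) * Complex.exp (j ^ 2 / 2))
          * Complex.exp ((2 * Real.pi * Complex.I * ((j : ℂ) - q)) * m) := by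
      intro m
      rw [integral_cexp_quadratic (by norm_num),
        mul_assoc ((Real.pi / (1 / 2) : ℂ) ^ (1 / 2 : ℂ)), ← Complex.exp_add, neg_neg]
      congr 2
      ring_nf
      rw [Complex.I_sq]
      ring
    simp_rw [h2]
    rw [integral_const_mul, ← intervalIntegral.integral_of_le zero_le_one,
      integral_exp_two_pi_mul]
    split_ifs with h
    · subst h; simp
    · simp
  · have hb : Integrable (fun z : ℝ × ℝ => Complex.exp (-(1 / 2) * z.1 ^ 2 + j * z.1 + 0)
        * ((Real.exp (2 * Real.pi ^ 2) : ℝ) : ℂ))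
        (volume.prod (volume.restrict (Set.Ioc (0 : ℝ) 1))) :=
      Integrable.mul_prod (g := fun _ => ((Real.exp (2 * Real.pi ^ 2) : ℝ) : ℂ))
        (integrable_cexp_quadratic' (by norm_num) _ _) (integrable_const _)
    refine hb.mono (by unfold Function.uncurry; fun_prop) ?_
    have hpos : ∀ᵐ z : ℝ × ℝ ∂(volume.prod (volume.restrict (Set.Ioc (0 : ℝ) 1))),
        z.2 ∈ Set.Ioc (0 : ℝ) 1 :=
      Measure.quasiMeasurePreserving_snd.ae (ae_restrict_mem measurableSet_Ioc)
    filter_upwards [hpos] with z hz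
    have h2 : z.2 ^ 2 ≤ 1 := by nlinarith [hz.1, hz.2]
    rw [Function.uncurry, norm_mul, Complex.norm_exp, Complex.norm_exp, Complex.norm_real,
      Real.norm_of_nonneg (Real.exp_pos _).le, ← Real.exp_add]
    have e1 : (-(1 / 2) * (z.1 : ℂ) ^ 2 + (j + 2 * Real.pi * Complex.I * z.2) * z.1 +
        (2 * Real.pi ^ 2 * z.2 ^ 2 - 2 * Real.pi * Complex.I * z.2 * q))
        = ((-(z.1 ^ 2) / 2 + j * z.1 + 2 * Real.pi ^ 2 * z.2 ^ 2 : ℝ) : ℂ)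
        + ((2 * Real.pi * z.2 * z.1 - 2 * Real.pi * z.2 * q : ℝ) : ℂ) * Complex.I := by
      push_cast; ring
    have e2 : (-(1 / 2) * (z.1 : ℂ) ^ 2 + j * z.1 + 0) = ((-(z.1 ^ 2) / 2 + j * z.1 : ℝ) : ℂ) := by
      push_cast; ring
    rw [e1, e2, Complex.add_re, Complex.re_ofReal_mul, Complex.ofReal_re, Complex.ofReal_re]
    simp only [Complex.I_re, mul_zero, add_zero]
    gcongr Real.exp ?_
    nlinarith [mul_le_mul_of_nonneg_left h2 (by positivity : 0 ≤ 2 * Real.pi ^ 2)]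

/-- `κ` is rapidly decreasing at both ends of the half-line, and all its moments vanish except the
`q`-th, which is `1`. -/
structure IsMomentFunction (q : ℕ) (κ : ℝ → ℂ) : Prop where
  meas : Measurable κ
  bound : ∀ k : ℕ, ∃ C, ∀ y, 0 < y → (1 / y + y) ^ k * ‖κ y‖ ≤ C
  moment : ∀ j : ℕ, ∫ y in Set.Ioi (0 : ℝ), κ y * (y : ℂ) ^ j = if j = q then 1 else 0

theorem exists_isMomentFunction (q : ℕ) : ∃ κ : ℝ → ℂ, IsMomentFunction q κ := by
  set c : ℂ := (Real.pi / (1 / 2) : ℂ) ^ (1 / 2 : ℂ) * Complex.exp (q ^ 2 / 2) with hc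
  have hc0 : c ≠ 0 := by
    refine mul_ne_zero ?_ (Complex.exp_ne_zero _)
    rw [Ne, Complex.cpow_eq_zero_iff]
    simp [Real.pi_ne_zero]
  refine ⟨fun y => ((y⁻¹ : ℝ) : ℂ) * (c⁻¹ * gaussianPacket q (Real.log y)), ?_, fun k => ?_,
    fun j => ?_⟩
  · exact (Complex.measurable_ofReal.comp measurable_inv).mul
      (measurable_const.mul ((continuous_gaussianPacket q).measurable.comp Real.measurable_log))
  · refine ⟨2 ^ k * (‖c⁻¹‖ * Real.exp (2 * Real.pi ^ 2)) * Real.exp ((k + 1) ^ 2 / 2),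
      fun y hy => ?_⟩
    obtain ⟨t, rfl⟩ : ∃ t, y = Real.exp t := ⟨Real.log y, (Real.exp_log hy).symm⟩
    rw [norm_mul, norm_mul, Complex.norm_real, Real.norm_of_nonneg (by positivity), Real.log_exp,
      one_div, ← Real.exp_neg]
    have h1 : Real.exp (-t) ≤ Real.exp |t| := Real.exp_le_exp.2 (neg_le_abs t)
    have h2 : Real.exp t ≤ Real.exp |t| := Real.exp_le_exp.2 (le_abs_self t)
    calc (Real.exp (-t) + Real.exp t) ^ k
          * (Real.exp (-t) * (‖c⁻¹‖ * ‖gaussianPacket q t‖))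
        ≤ (2 * Real.exp |t|) ^ k * (Real.exp |t| *
          (‖c⁻¹‖ * (Real.exp (2 * Real.pi ^ 2) * Real.exp (-(t ^ 2) / 2)))) := by
          gcongr
          · linarith
          · exact norm_gaussianPacket_le q t
      _ = 2 ^ k * (‖c⁻¹‖ * Real.exp (2 * Real.pi ^ 2))
          * Real.exp ((k + 1) * |t| - t ^ 2 / 2) := by
          rw [mul_pow, ← Real.exp_nat_mul,
            show (k + 1) * |t| - t ^ 2 / 2 = k * |t| + |t| + -(t ^ 2) / 2 by ring,
            Real.exp_add, Real.exp_add]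
          ring
      _ ≤ _ := by
          gcongr
          nlinarith [sq_nonneg ((k + 1 : ℝ) - |t|), sq_abs t]
  · have h1 := integral_Ioi_inv_mul_eq_integral_exp
      (fun y => c⁻¹ * (gaussianPacket q (Real.log y) * (y : ℂ) ^ j))
    simp only [Real.log_exp] at h1
    rw [integral_const_mul, integral_gaussianPacket_mul_exp] at h1
    rw [show (fun y : ℝ => ((y⁻¹ : ℝ) : ℂ) * (c⁻¹ * gaussianPacket q (Real.log y)) * (y : ℂ) ^ j)
      = fun y : ℝ => ((y⁻¹ : ℝ) : ℂ) * (c⁻¹ * (gaussianPacket q (Real.log y) * (y : ℂ) ^ j)) by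
        ext y; ring, h1]
    split_ifs
    · exact inv_mul_cancel₀ hc0
    · exact mul_zero _

theorem IsMomentFunction.integrable {q : ℕ} {κ : ℝ → ℂ} (hκ : IsMomentFunction q κ) (j : ℕ) :
    Integrable (fun y => κ y * (y : ℂ) ^ j) (volume.restrict (Set.Ioi 0)) := by
  obtain ⟨C, hC⟩ := hκ.bound (j + 2)
  refine (integrable_inv_one_add_sq.integrableOn.const_mul C).mono'
    (hκ.meas.mul (by fun_prop)).aestronglyMeasurable ?_
  filter_upwards [ae_restrict_mem measurableSet_Ioi] with y hy
  have hy : 0 < y := hy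
  have h0 : 0 < 1 / y := by positivity
  rw [norm_mul, norm_pow, Complex.norm_real, Real.norm_of_nonneg hy.le, ← div_eq_mul_inv,
    le_div_iff₀ (by positivity)]
  refine le_trans ?_ (hC y hy)
  have h1 : y ^ j ≤ (1 / y + y) ^ j := by gcongr; linarith
  have h2 : 1 + y ^ 2 ≤ (1 / y + y) ^ 2 := by
    have : 1 / y * y = 1 := by field_simp
    nlinarith [sq_nonneg (1 / y)]
  calc ‖κ y‖ * y ^ j * (1 + y ^ 2) ≤ ‖κ y‖ * (1 / y + y) ^ j * (1 / y + y) ^ 2 := by gcongr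
    _ = _ := by ring

/-! ### Taylor expansion of Schwartz functions along rays -/

theorem iteratedDeriv_comp_smul (ψ : 𝓢(Rn n, ℂ)) (v : Rn n) (j : ℕ) (r : ℝ) :
    iteratedDeriv j (fun r : ℝ => ψ (r • v)) r = iteratedFDeriv ℝ j ψ (r • v) fun _ => v := by
  have h := ContinuousLinearMap.iteratedFDeriv_comp_right (ContinuousLinearMap.toSpanSingleton ℝ v)
    (ψ.smooth ⊤) r (i := j) (by exact_mod_cast le_top)
  rw [iteratedDeriv, show (fun r : ℝ => ψ (r • v)) = ψ ∘ (ContinuousLinearMap.toSpanSingleton ℝ v)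
    from rfl, h]
  simp

theorem exists_taylor_remainder_le (ψ : 𝓢(Rn n, ℂ)) (N : ℕ) :
    ∃ C, 0 ≤ C ∧ ∀ v : Rn n, ‖ψ v - ∑ j ∈ Finset.range (N + 1),
      ((j.factorial : ℂ)⁻¹ * iteratedFDeriv ℝ j ψ 0 fun _ => v)‖ ≤ C * ‖v‖ ^ (N + 1) := by
  refine ⟨SchwartzMap.seminorm ℂ 0 (N + 1) ψ, apply_nonneg _ _, fun v => ?_⟩
  have hg : ContDiff ℝ (N + 1 : ℕ) (fun r : ℝ => ψ (r • v)) :=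
    (ψ.smooth _).comp (contDiff_id.smul contDiff_const)
  have hit : ∀ j ≤ N + 1, ∀ r ∈ Set.Icc (0 : ℝ) 1,
      iteratedDerivWithin j (fun r : ℝ => ψ (r • v)) (Set.Icc 0 1) r
        = iteratedFDeriv ℝ j ψ (r • v) fun _ => v := by
    intro j hj r hr
    rw [iteratedDerivWithin_eq_iteratedDeriv (uniqueDiffOn_Icc zero_lt_one)
      ((hg.of_le (by exact_mod_cast hj)).contDiffAt) hr, iteratedDeriv_comp_smul]
  have h := taylor_mean_remainder_bound (f := fun r : ℝ => ψ (r • v)) (a := 0) (b := 1) (x := 1)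
    (n := N) (C := SchwartzMap.seminorm ℂ 0 (N + 1) ψ * ‖v‖ ^ (N + 1)) zero_le_one
    hg.contDiffOn (by simp) (fun r hr => ?_)
  · rw [taylor_within_apply] at h
    simp only [sub_zero, one_pow, mul_one, one_smul] at h
    have hN : (1 : ℝ) ≤ (N.factorial : ℝ) := by exact_mod_cast N.factorial_pos
    refine (le_trans (le_of_eq ?_) h).trans
      (div_le_self (mul_nonneg (apply_nonneg _ _) (by positivity)) hN)
    congr 2
    refine Finset.sum_congr rfl fun j hj => ?_
    rw [hit j (by have := Finset.mem_range.1 hj; omega) 0 (by simp), zero_smul, Complex.real_smul]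
    push_cast
    rfl
  · rw [hit _ le_rfl r hr]
    refine (ContinuousMultilinearMap.le_opNorm _ _).trans ?_
    rw [Finset.prod_const, Finset.card_univ, Fintype.card_fin]
    gcongr
    simpa using SchwartzMap.le_seminorm ℂ 0 (N + 1) ψ (r • v)

/-- Integrating `ψ` along rays against a moment function reproduces one homogeneous term of the
Taylor expansion of `ψ` at the origin, up to an error vanishing there to any given order. -/
theorem exists_integral_moment_sub_le {q : ℕ} {κ : ℝ → ℂ} (hκ : IsMomentFunction q κ)
    (ψ : 𝓢(Rn n, ℂ)) {N : ℕ} (hN : q ≤ N) :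
    ∃ C, ∀ u : Rn n, ‖(∫ y in Set.Ioi (0 : ℝ), κ y * ψ (-(y • u)))
      - (-1) ^ q * ((q.factorial : ℂ)⁻¹ * iteratedFDeriv ℝ q ψ 0 fun _ => u)‖
      ≤ C * ‖u‖ ^ (N + 1) := by
  obtain ⟨C, hC0, hC⟩ := exists_taylor_remainder_le ψ N
  refine ⟨∫ y in Set.Ioi (0 : ℝ), C * ‖κ y * (y : ℂ) ^ (N + 1)‖, fun u => ?_⟩
  set D : ℕ → ℂ := fun j => iteratedFDeriv ℝ j ψ 0 fun _ => u with hD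
  have hhom : ∀ (j : ℕ) (y : ℝ), iteratedFDeriv ℝ j ψ 0 (fun _ => -(y • u))
      = (-1) ^ j * (y : ℂ) ^ j * D j := by
    intro j y
    have := (iteratedFDeriv ℝ j ψ 0).map_smul_univ (fun _ => -y) (fun _ => u)
    simp only [Finset.prod_const, Finset.card_univ, Fintype.card_fin, neg_smul] at this
    rw [this, Complex.real_smul, ← mul_pow]
    push_cast
    ring
  have hterm : ∀ j, Integrable (fun y : ℝ => ((-1) ^ j * ((j.factorial : ℂ)⁻¹ * D j))
      * (κ y * (y : ℂ) ^ j)) (volume.restrict (Set.Ioi 0)) :=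
    fun j => (hκ.integrable j).const_mul _
  have hint : Integrable (fun y : ℝ => κ y * ψ (-(y • u))) (volume.restrict (Set.Ioi 0)) := by
    refine ((hκ.integrable 0).norm.mul_const (SchwartzMap.seminorm ℂ 0 0 ψ)).mono'
      (hκ.meas.mul (by fun_prop)).aestronglyMeasurable (Filter.Eventually.of_forall fun y => ?_)
    rw [norm_mul, pow_zero, mul_one]
    gcongr
    exact SchwartzMap.norm_le_seminorm ℂ ψ _
  have hsum : ∫ y in Set.Ioi (0 : ℝ), ∑ j ∈ Finset.range (N + 1),
      ((-1) ^ j * ((j.factorial : ℂ)⁻¹ * D j)) * (κ y * (y : ℂ) ^ j)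
      = (-1) ^ q * ((q.factorial : ℂ)⁻¹ * D q) := by
    rw [integral_finsetSum _ fun j _ => hterm j]
    simp_rw [integral_const_mul, hκ.moment]
    rw [Finset.sum_eq_single q]
    · simp
    · intro j _ hj; simp [hj]
    · intro h; exact absurd (Finset.mem_range.2 (Nat.lt_succ_of_le hN)) h
  rw [← hsum, ← integral_sub hint (integrable_finsetSum _ fun j _ => hterm j),
    ← integral_mul_const]
  refine norm_integral_le_of_norm_le (((hκ.integrable (N + 1)).norm.const_mul C).mul_const _) ?_
  filter_upwards [ae_restrict_mem measurableSet_Ioi] with y hy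
  have hy : 0 < y := hy
  have h1 := hC (-(y • u))
  simp_rw [hhom] at h1
  rw [norm_neg, norm_smul, Real.norm_of_nonneg hy.le] at h1
  have h2 : κ y * ψ (-(y • u)) - ∑ j ∈ Finset.range (N + 1),
      ((-1) ^ j * ((j.factorial : ℂ)⁻¹ * D j)) * (κ y * (y : ℂ) ^ j)
      = κ y * (ψ (-(y • u)) - ∑ j ∈ Finset.range (N + 1),
        (j.factorial : ℂ)⁻¹ * ((-1) ^ j * (y : ℂ) ^ j * D j)) := by
    rw [mul_sub, Finset.mul_sum]
    congr 1
    exact Finset.sum_congr rfl fun j _ => by ring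
  rw [h2, norm_mul, norm_mul, norm_pow, Complex.norm_real, Real.norm_of_nonneg hy.le]
  calc ‖κ y‖ * _ ≤ ‖κ y‖ * (C * (y * ‖u‖) ^ (N + 1)) := by gcongr
    _ = _ := by ring

/-! ### Functions flat at the origin -/

/-- `h` vanishes to infinite order at the origin. As Schwartz functions are bounded, the estimates
can be required on the whole space. -/
def IsFlat (h : 𝓢(Rn n, ℂ)) : Prop := ∀ N : ℕ, ∃ C, ∀ u, ‖h u‖ ≤ C * ‖u‖ ^ N

theorem hasDerivAt_comp_add_smul (h : 𝓢(Rn n, ℂ)) (u v : Rn n) (r : ℝ) :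
    HasDerivAt (fun r : ℝ => h (u + r • v)) (∂_{v} h (u + r • v)) r := by
  have h1 : HasDerivAt (fun r : ℝ => u + r • v) v r := by
    simpa using ((hasDerivAt_id r).smul_const v).const_add u
  rw [SchwartzMap.lineDerivOp_apply_eq_fderiv]
  exact (h.differentiableAt.hasFDerivAt).comp_hasDerivAt r h1

theorem norm_sub_sub_lineDeriv_le (h : 𝓢(Rn n, ℂ)) (u v : Rn n) {s : ℝ} (hs : 0 ≤ s) :
    ‖h (u + s • v) - h u - s * ∂_{v} h u‖
      ≤ SchwartzMap.seminorm ℂ 0 0 (∂_{v} (∂_{v} h)) * s ^ 2 := by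
  set M := SchwartzMap.seminorm ℂ 0 0 (∂_{v} (∂_{v} h)) with hM
  have h1 : ∀ r ∈ Set.Icc (0 : ℝ) s, ‖∂_{v} h (u + r • v) - ∂_{v} h u‖ ≤ M * s := by
    intro r hr
    have := norm_image_sub_le_of_norm_deriv_le_segment' (f := fun r : ℝ => ∂_{v} h (u + r • v))
      (a := 0) (b := s) (C := M)
      (fun x _ => (hasDerivAt_comp_add_smul (∂_{v} h) u v x).hasDerivWithinAt)
      (fun x _ => SchwartzMap.norm_le_seminorm ℂ _ _) r hr
    simp only [zero_smul, add_zero, sub_zero] at this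
    exact this.trans (mul_le_mul_of_nonneg_left hr.2 (apply_nonneg _ _))
  have h2 := norm_image_sub_le_of_norm_deriv_le_segment'
    (f := fun r : ℝ => h (u + r • v) - (r : ℂ) * ∂_{v} h u) (a := 0) (b := s) (C := M * s)
    (f' := fun r => ∂_{v} h (u + r • v) - ∂_{v} h u)
    (fun x _ => by
      have h3 := ((hasDerivAt_id x).ofReal_comp).mul_const (∂_{v} h u)
      simp only [Complex.ofReal_one, one_mul] at h3
      exact ((hasDerivAt_comp_add_smul h u v x).sub h3).hasDerivWithinAt)
    (fun x hx => h1 x ⟨hx.1, hx.2.le⟩) s ⟨hs, le_rfl⟩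
  simp only [zero_smul, add_zero, sub_zero, Complex.ofReal_zero, zero_mul] at h2
  rw [sub_right_comm]
  refine h2.trans_eq (by ring)

/-- Flatness passes to derivatives, by the Landau type interpolation of the first derivative
between the function and its second derivative. -/
theorem IsFlat.lineDeriv {h : 𝓢(Rn n, ℂ)} (hh : IsFlat h) (v : Rn n) : IsFlat (∂_{v} h) := by
  intro N
  obtain ⟨C, hC⟩ := hh (2 * (N + 1))
  have hC0 : 0 ≤ |C| := abs_nonneg C
  have hC' : ∀ u, ‖h u‖ ≤ |C| * ‖u‖ ^ (2 * (N + 1)) := fun u =>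
    (hC u).trans (by gcongr; exact le_abs_self C)
  set M := SchwartzMap.seminorm ℂ 0 0 (∂_{v} (∂_{v} h)) with hM
  have hM0 : 0 ≤ M := apply_nonneg _ _
  set B := SchwartzMap.seminorm ℂ 0 0 (∂_{v} h) with hB
  have hB0 : 0 ≤ B := apply_nonneg _ _
  set A := |C| * (1 + ‖v‖) ^ (2 * (N + 1)) + |C| + M with hA
  have hA0 : 0 ≤ A := by positivity
  refine ⟨A + B, fun u => ?_⟩
  rcases le_total 1 ‖u‖ with h1 | h1
  · have : 1 ≤ ‖u‖ ^ N := one_le_pow₀ h1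
    calc ‖∂_{v} h u‖ ≤ B := SchwartzMap.norm_le_seminorm ℂ _ _
      _ ≤ A + B := by linarith
      _ ≤ (A + B) * ‖u‖ ^ N := le_mul_of_one_le_right (by linarith) this
  rcases eq_or_ne u 0 with rfl | hu
  · have h2 : HasFDerivAt (h : Rn n → ℂ) (0 : Rn n →L[ℝ] ℂ) 0 := by
      refine Asymptotics.IsBigO.hasFDerivAt (n := 2 * (N + 1)) ?_ (by omega)
      refine Asymptotics.IsBigO.of_bound C (Filter.Eventually.of_forall fun x => ?_)
      rw [sub_zero, Real.norm_of_nonneg (by positivity)]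
      exact hC x
    rw [SchwartzMap.lineDerivOp_apply_eq_fderiv, h2.fderiv]
    simp only [zero_apply, norm_zero]
    positivity
  have hu0 : 0 < ‖u‖ := norm_pos_iff.2 hu
  -- the step `s` balances the two error terms
  set s := ‖u‖ ^ (N + 1) with hs
  have hs0 : 0 < s := by positivity
  have hsu : s ≤ ‖u‖ := by
    rw [hs]; exact (pow_le_of_le_one hu0.le h1 (by omega))
  have h2 := norm_sub_sub_lineDeriv_le h u v hs0.le
  have h3 : ‖h (u + s • v)‖ ≤ |C| * (1 + ‖v‖) ^ (2 * (N + 1)) * s ^ 2 := by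
    have : ‖u + s • v‖ ≤ (1 + ‖v‖) * ‖u‖ := by
      refine (norm_add_le _ _).trans ?_
      rw [norm_smul, Real.norm_of_nonneg hs0.le]
      nlinarith [mul_le_mul_of_nonneg_right hsu (norm_nonneg v)]
    calc ‖h (u + s • v)‖ ≤ |C| * ‖u + s • v‖ ^ (2 * (N + 1)) := hC' _
      _ ≤ |C| * ((1 + ‖v‖) * ‖u‖) ^ (2 * (N + 1)) := by gcongr
      _ = _ := by rw [hs, mul_pow]; ring
  have h4 : ‖h u‖ ≤ |C| * s ^ 2 := (hC' u).trans_eq (by rw [hs]; ring)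
  have h5 : s * ‖∂_{v} h u‖ ≤ A * s ^ 2 := by
    have : (s : ℂ) * ∂_{v} h u
        = h (u + s • v) - h u - (h (u + s • v) - h u - s * ∂_{v} h u) := by ring
    calc s * ‖∂_{v} h u‖ = ‖(s : ℂ) * ∂_{v} h u‖ := by
          rw [norm_mul, Complex.norm_real, Real.norm_of_nonneg hs0.le]
      _ ≤ ‖h (u + s • v)‖ + ‖h u‖ + M * s ^ 2 := by
          rw [this]
          exact (norm_sub_le _ _).trans (add_le_add (norm_sub_le _ _) h2)
      _ ≤ A * s ^ 2 := by rw [hA]; linarith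
  have h6 : ‖∂_{v} h u‖ ≤ A * s := by
    refine le_of_mul_le_mul_left ?_ hs0
    calc _ ≤ A * s ^ 2 := h5
      _ = _ := by ring
  calc ‖∂_{v} h u‖ ≤ A * s := h6
    _ ≤ A * ‖u‖ ^ N := by
        gcongr A * ?_
        exact pow_le_pow_of_le_one hu0.le h1 (by omega)
    _ ≤ (A + B) * ‖u‖ ^ N := by gcongr; linarith

theorem IsFlat.iteratedLineDeriv {h : 𝓢(Rn n, ℂ)} (hh : IsFlat h) {j : ℕ} (m : Fin j → Rn n) :
    IsFlat (∂^{m} h) := by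
  induction j with
  | zero => simpa using hh
  | succ j ih =>
    rw [LineDeriv.iteratedLineDerivOp_succ_left]
    exact (ih _).lineDeriv _

theorem IsFlat.apply_zero {h : 𝓢(Rn n, ℂ)} (hh : IsFlat h) : h 0 = 0 := by
  obtain ⟨C, hC⟩ := hh 1
  simpa using hC 0

theorem IsFlat.vanishesToOrder {h : 𝓢(Rn n, ℂ)} (hh : IsFlat h) (N : ℕ) : VanishesToOrder N h :=
  (vanishesToOrder_iff_lineDeriv N h).2 fun _ _ => (hh.iteratedLineDeriv _).apply_zero

theorem isFlat_of_eventually_eq_zero {h : 𝓢(Rn n, ℂ)} (hh : ∀ᶠ u in nhds 0, h u = 0) :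
    IsFlat h := by
  obtain ⟨δ, hδ, hb⟩ := Metric.eventually_nhds_iff.1 hh
  intro N
  refine ⟨SchwartzMap.seminorm ℂ 0 0 h / δ ^ N, fun u => ?_⟩
  have h0 : 0 ≤ SchwartzMap.seminorm ℂ 0 0 h := apply_nonneg _ _
  rcases lt_or_ge ‖u‖ δ with h1 | h1
  · rw [hb (by simpa using h1), norm_zero]
    positivity
  · calc ‖h u‖ ≤ SchwartzMap.seminorm ℂ 0 0 h := SchwartzMap.norm_le_seminorm ℂ _ _
      _ = SchwartzMap.seminorm ℂ 0 0 h / δ ^ N * δ ^ N := by field_simp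
      _ ≤ _ := by gcongr

/-! ### Constant coefficient operators on the Fourier side -/

theorem fourier_lineDeriv_apply (ρ : 𝓢(Rn n, ℂ)) (v ξ : Rn n) :
    𝓕 (∂_{v} ρ) ξ = 2 * Real.pi * Complex.I * (inner ℝ ξ v : ℝ) * 𝓕 ρ ξ := by
  have : Function.HasTemperateGrowth (fun x : Rn n => inner ℝ x v) := by fun_prop
  rw [SchwartzMap.fourier_lineDerivOp_eq, smul_apply,
    SchwartzMap.smulLeftCLM_apply_apply this, Complex.real_smul, smul_eq_mul]
  ring

theorem fourier_injective : Function.Injective (fun ρ : 𝓢(Rn n, ℂ) => 𝓕 ρ) := fun ρ σ h => by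
  have := congrArg (fun g : 𝓢(Rn n, ℂ) => 𝓕⁻ g) h
  simpa using this

theorem lineDeriv_comm (ρ : 𝓢(Rn n, ℂ)) (v w : Rn n) : ∂_{v} (∂_{w} ρ) = ∂_{w} (∂_{v} ρ) := by
  refine fourier_injective (SchwartzMap.ext fun ξ => ?_)
  simp only [fourier_lineDeriv_apply]
  ring

section Transpose

variable {X : Type*} [AddCommGroup X] [Module ℂ X] [TopologicalSpace X]
  [IsTopologicalAddGroup X] [ContinuousConstSMul ℂ X]

theorem exists_transpose_iterate (X : Type*) [AddCommGroup X] [Module ℂ X] [TopologicalSpace X]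
    [IsTopologicalAddGroup X] [ContinuousConstSMul ℂ X] (v : Rn n) (k : ℕ) :
    ∃ D : 𝓢(Rn n, ℂ) →L[ℂ] 𝓢(Rn n, ℂ),
      (∀ (f : 𝓢'(Rn n, X)) (ρ : 𝓢(Rn n, ℂ)),
        ((fun h : 𝓢'(Rn n, X) => ∂_{v} h)^[k] f) ρ = f (D ρ)) ∧
      ∀ (ρ : 𝓢(Rn n, ℂ)) ξ,
        𝓕 (D ρ) ξ = (-(2 * Real.pi * Complex.I) * (inner ℝ ξ v : ℝ)) ^ k * 𝓕 ρ ξ := by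
  induction k with
  | zero => exact ⟨ContinuousLinearMap.id ℂ _, fun f ρ => rfl, fun ρ ξ => by simp⟩
  | succ k ih =>
    obtain ⟨D, hD, hD'⟩ := ih
    refine ⟨D ∘L (-LineDeriv.lineDerivOpCLM ℂ 𝓢(Rn n, ℂ) v), fun f ρ => ?_, fun ρ ξ => ?_⟩
    · rw [Function.iterate_succ_apply', TemperedDistribution.lineDerivOp_apply_apply, hD]
      rfl
    · change 𝓕 (D (-∂_{v} ρ)) ξ = _
      rw [hD', FourierTransform.fourier_neg, neg_apply, fourier_lineDeriv_apply]
      ring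

/-- The transpose of `∂^m` on the test functions, and its symbol. -/
theorem exists_transpose_partialDeriv (X : Type*) [AddCommGroup X] [Module ℂ X]
    [TopologicalSpace X] [IsTopologicalAddGroup X] [ContinuousConstSMul ℂ X] (m : Fin n →₀ ℕ) :
    ∃ D : 𝓢(Rn n, ℂ) →L[ℂ] 𝓢(Rn n, ℂ),
      (∀ (f : 𝓢'(Rn n, X)) (ρ : 𝓢(Rn n, ℂ)), (partialDeriv m f) ρ = f (D ρ)) ∧
      ∀ (ρ : 𝓢(Rn n, ℂ)) ξ,
        𝓕 (D ρ) ξ = (∏ i, (-(2 * Real.pi * Complex.I) * (ξ i : ℂ)) ^ m i) * 𝓕 ρ ξ := by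
  have key : ∀ L : List (Fin n), ∃ D : 𝓢(Rn n, ℂ) →L[ℂ] 𝓢(Rn n, ℂ),
      (∀ (f : 𝓢'(Rn n, X)) (ρ : 𝓢(Rn n, ℂ)), (L.foldr (fun i g => (fun h : 𝓢'(Rn n, X) =>
        ∂_{(EuclideanSpace.single i (1 : ℝ) : Rn n)} h)^[m i] g) f) ρ = f (D ρ)) ∧
      ∀ (ρ : 𝓢(Rn n, ℂ)) ξ,
        𝓕 (D ρ) ξ = (L.map fun i => (-(2 * Real.pi * Complex.I) * (ξ i : ℂ)) ^ m i).prod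
          * 𝓕 ρ ξ := by
    intro L
    induction L with
    | nil => exact ⟨ContinuousLinearMap.id ℂ _, fun f ρ => rfl, fun ρ ξ => by simp⟩
    | cons i L ih =>
      obtain ⟨D, hD, hD'⟩ := ih
      obtain ⟨D₁, h₁, h₁'⟩ := exists_transpose_iterate X (EuclideanSpace.single i (1 : ℝ)) (m i)
      refine ⟨D ∘L D₁, fun f ρ => ?_, fun ρ ξ => ?_⟩
      · rw [List.foldr_cons, h₁, hD]
        rfl
      · change 𝓕 (D (D₁ ρ)) ξ = _
        rw [hD', h₁', List.map_cons, List.prod_cons, EuclideanSpace.inner_single_right]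
        simp only [conj_trivial, one_mul]
        ring
  obtain ⟨D, hD, hD'⟩ := key (List.finRange n)
  refine ⟨D, hD, fun ρ ξ => ?_⟩
  rw [hD', ← List.ofFn_eq_map, List.prod_ofFn]

theorem exists_transpose_diffOp (f : 𝓢'(Rn n, X)) (P : MvPolynomial (Fin n) ℂ) :
    ∃ D : 𝓢(Rn n, ℂ) →L[ℂ] 𝓢(Rn n, ℂ),
      (∀ ρ : 𝓢(Rn n, ℂ), (diffOp P f) ρ = f (D ρ)) ∧
      ∀ (ρ : 𝓢(Rn n, ℂ)) ξ,
        𝓕 (D ρ) ξ = MvPolynomial.eval (fun i => -(2 * Real.pi * Complex.I) * (ξ i : ℂ)) P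
          * 𝓕 ρ ξ := by
  choose D hD hD' using exists_transpose_partialDeriv (n := n) X
  have key : ∀ s : Finset (Fin n →₀ ℕ), (∀ ρ : 𝓢(Rn n, ℂ),
      (∑ m ∈ s, P.coeff m • partialDeriv m f) ρ = f ((∑ m ∈ s, P.coeff m • D m) ρ)) ∧
      ∀ (ρ : 𝓢(Rn n, ℂ)) ξ, 𝓕 ((∑ m ∈ s, P.coeff m • D m) ρ) ξ
        = (∑ m ∈ s, P.coeff m * ∏ i, (-(2 * Real.pi * Complex.I) * (ξ i : ℂ)) ^ m i)
          * 𝓕 ρ ξ := by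
    intro s
    induction s using Finset.cons_induction with
    | empty =>
      refine ⟨fun ρ => ?_, fun ρ ξ => ?_⟩
      · simp
      · simp
    | cons m s hm ih =>
      refine ⟨fun ρ => ?_, fun ρ ξ => ?_⟩
      · rw [Finset.sum_cons, Finset.sum_cons, add_apply, add_apply, ih.1, map_add, smul_apply,
          smul_apply, hD, map_smul]
      · rw [Finset.sum_cons, Finset.sum_cons, add_apply, FourierTransform.fourier_add,
          add_apply, ih.2, smul_apply, FourierTransform.fourier_smul,
          smul_apply, hD', smul_eq_mul]
        ring
  refine ⟨∑ m ∈ P.support, P.coeff m • D m, (key _).1, fun ρ ξ => ?_⟩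
  rw [(key _).2, MvPolynomial.eval_eq']

end Transpose

/-! ### The homogeneous Taylor terms -/

theorem eval_taylorTerm (φ : 𝓢(Rn n, ℂ)) (q : ℕ) (u : Fin n → ℂ) :
    MvPolynomial.eval u (taylorTerm φ q) = ∑ m ∈ (Finset.univ : Finset (Fin n)).finsuppAntidiag q,
      partialDeriv m (fourierS n φ) 0 / ((∏ i, (m i).factorial : ℕ) : ℂ) * ∏ i, u i ^ m i := by
  rw [taylorTerm, map_sum]
  refine Finset.sum_congr rfl fun m _ => ?_
  rw [MvPolynomial.eval_monomial, Finsupp.prod_fintype _ _ fun i => pow_zero _]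

theorem eval_mul_taylorTerm (φ : 𝓢(Rn n, ℂ)) (q : ℕ) (c : ℂ) (u : Fin n → ℂ) :
    MvPolynomial.eval (fun i => c * u i) (taylorTerm φ q)
      = c ^ q * MvPolynomial.eval u (taylorTerm φ q) := by
  rw [eval_taylorTerm, eval_taylorTerm, Finset.mul_sum]
  refine Finset.sum_congr rfl fun m hm => ?_
  have hm' : ∑ i, m i = q := (Finset.mem_finsuppAntidiag.1 hm).1
  simp_rw [mul_pow]
  rw [Finset.prod_mul_distrib, Finset.prod_pow_eq_pow_sum, hm']
  ring

/-- The `q`-homogeneous Taylor term at the real vector `v` is `(q!)⁻¹ ∂_v^q φ̂ (0)`: this is the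
multinomial theorem for the commuting operators `v i • ∂_i`, whose sum is `∂_v`. -/
theorem eval_taylorTerm_eq_iteratedFDeriv (φ : 𝓢(Rn n, ℂ)) (q : ℕ) (v : Rn n) :
    MvPolynomial.eval (fun i => (v i : ℂ)) (taylorTerm φ q)
      = (q.factorial : ℂ)⁻¹ * iteratedFDeriv ℝ q (fourierS n φ) 0 fun _ => v := by
  set ψ := fourierS n φ with hψ
  let e : Fin n → Rn n := fun i => EuclideanSpace.single i 1
  let A : Fin n → Module.End ℂ 𝓢(Rn n, ℂ) := fun i =>
    (v i : ℂ) • (LineDeriv.lineDerivOpCLM ℂ 𝓢(Rn n, ℂ) (e i)).toLinearMap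
  have hA : ∀ i (h : 𝓢(Rn n, ℂ)), A i h = (v i : ℂ) • ∂_{e i} h := fun i h => rfl
  have hcomm : ((Finset.univ : Finset (Fin n)) : Set (Fin n)).Pairwise
      (Function.onFun Commute A) := by
    intro i _ j _ _
    refine LinearMap.ext fun h => ?_
    simp only [Module.End.mul_apply, hA, LineDeriv.lineDerivOp_smul, lineDeriv_comm h (e i) (e j)]
    rw [smul_comm]
  have hsum : ∀ h : 𝓢(Rn n, ℂ), (∑ i, A i) h = ∂_{v} h := by
    intro h
    have hv : v = ∑ i, v i • e i := by
      ext j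
      simp [e, Finset.sum_apply, Pi.single_apply]
    ext x
    conv_rhs => rw [hv]
    rw [SchwartzMap.lineDerivOp_apply_eq_fderiv, map_sum, LinearMap.sum_apply]
    rw [show (∑ i, A i h) x = ∑ i, A i h x from map_sum (evalAt x) _ _]
    refine Finset.sum_congr rfl fun i _ => ?_
    rw [hA, smul_apply, SchwartzMap.lineDerivOp_apply_eq_fderiv, map_smul,
      Complex.real_smul, smul_eq_mul]
  have hpow : ∀ k : ℕ, (((∑ i, A i) ^ k) ψ) 0 = iteratedFDeriv ℝ k ψ 0 fun _ => v := by
    intro k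
    rw [← SchwartzMap.iteratedLineDerivOp_eq_iteratedFDeriv,
      LineDeriv.iteratedLineDerivOp_const_eq_iter_lineDerivOp, Module.End.pow_apply]
    congr 2
    exact funext hsum
  have hApow : ∀ i (k : ℕ) (h : 𝓢(Rn n, ℂ)),
      (A i ^ k) h = (v i : ℂ) ^ k • (fun g : 𝓢(Rn n, ℂ) => ∂_{e i} g)^[k] h := by
    intro i k h
    induction k with
    | zero => simp
    | succ k ih =>
      rw [pow_succ', Module.End.mul_apply, ih, hA, LineDeriv.lineDerivOp_smul, smul_smul,
        Function.iterate_succ_apply', ← pow_succ']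
  have hlist : ∀ (m : Fin n → ℕ) (L : List (Fin n)),
      (L.map fun i => A i ^ m i).prod ψ = (L.map fun i => (v i : ℂ) ^ m i).prod •
        L.foldr (fun i g => (fun h : 𝓢(Rn n, ℂ) => ∂_{e i} h)^[m i] g) ψ := by
    intro m L
    induction L with
    | nil => simp
    | cons i L ih =>
      rw [List.map_cons, List.prod_cons, Module.End.mul_apply, ih, map_smul, hApow, smul_smul,
        List.map_cons, List.prod_cons, List.foldr_cons, mul_comm]
  rw [← hpow, Finset.sum_pow_eq_sum_piAntidiag_of_commute _ _ hcomm, eval_taylorTerm,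
    LinearMap.sum_apply]
  rw [show ∀ (s : Finset (Fin n → ℕ)) (g : (Fin n → ℕ) → 𝓢(Rn n, ℂ)),
    (∑ m ∈ s, g m) 0 = ∑ m ∈ s, g m 0 from fun s g => map_sum (evalAt 0) _ _, Finset.mul_sum]
  refine Finset.sum_nbij' (fun m => ⇑m) Finsupp.equivFunOnFinite.symm ?_ ?_ ?_ ?_ ?_
  · intro m hm
    simpa using (Finset.mem_finsuppAntidiag.1 hm).1
  · intro m hm
    rw [Finset.mem_finsuppAntidiag]
    exact ⟨by simpa using hm, Finset.subset_univ _⟩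
  · intro m _; ext; simp
  · intro m _; ext; simp
  · intro m hm
    have hm' : ∑ i, m i = q := (Finset.mem_finsuppAntidiag.1 hm).1
    have hmul := Nat.multinomial_spec (Finset.univ : Finset (Fin n)) m
    rw [hm'] at hmul
    have hprod : (Finset.univ : Finset (Fin n)).noncommProd (fun i => A i ^ m i)
        (hcomm.mono' fun _ _ h => h.pow_pow ..) ψ
        = (∏ i, (v i : ℂ) ^ m i) • partialDeriv m ψ := by
      have h1 := Finset.noncommProd_toFinset (List.finRange n) (fun i => A i ^ m i)
        (by
          intro i _ j _ hij
          exact (hcomm (Finset.mem_univ i) (Finset.mem_univ j) hij).pow_pow _ _)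
        (List.nodup_finRange n)
      simp only [List.toFinset_finRange] at h1
      rw [h1, hlist, ← List.ofFn_eq_map, List.prod_ofFn]
      rfl
    rw [Module.End.mul_apply, hprod, ← hmul]
    have h0 : ((∏ i, (m i).factorial : ℕ) : ℂ) ≠ 0 := by
      exact_mod_cast (Finset.prod_pos fun i _ => Nat.factorial_pos _).ne'
    have h1 : ((Nat.multinomial Finset.univ ⇑m : ℕ) : ℂ) ≠ 0 := by
      exact_mod_cast (Nat.multinomial_pos _ _).ne'
    rw [Module.End.natCast_apply,
      smul_apply, smul_apply, smul_eq_mul, nsmul_eq_mul]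
    push_cast at h0 ⊢
    field_simp
    exact mul_comm _ _

/-- The transpose of `P_q(∂)`, with its symbol `P_q (-2πi ξ)` expressed by the `q`-th derivative of
`φ̂` at the origin. -/
theorem exists_transpose_taylorTerm {X : Type*} [AddCommGroup X] [Module ℂ X] [TopologicalSpace X]
    [IsTopologicalAddGroup X] [ContinuousConstSMul ℂ X] (f : 𝓢'(Rn n, X)) (φ : 𝓢(Rn n, ℂ))
    (q : ℕ) :
    ∃ D : 𝓢(Rn n, ℂ) →L[ℂ] 𝓢(Rn n, ℂ),
      (∀ ρ : 𝓢(Rn n, ℂ), (diffOp (taylorTerm φ q) f) ρ = f (D ρ)) ∧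
      ∀ (ρ : 𝓢(Rn n, ℂ)) ξ, 𝓕 (D ρ) ξ = (-(2 * Real.pi * Complex.I)) ^ q *
        ((q.factorial : ℂ)⁻¹ * iteratedFDeriv ℝ q (fourierS n φ) 0 fun _ => ξ) * 𝓕 ρ ξ := by
  obtain ⟨D, hD, hD'⟩ := exists_transpose_diffOp f (taylorTerm φ q)
  refine ⟨D, hD, fun ρ ξ => ?_⟩
  rw [hD', eval_mul_taylorTerm, eval_taylorTerm_eq_iteratedFDeriv]

/-! ### Superpositions and their Fourier transforms -/

/-- On the Fourier side, the superposition with a kernel whose restriction to each horizontal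
hyperplane is a Schwartz function `S y` is an integral over the half-line only. -/
theorem fourier_superposition {φ σ : 𝓢(Rn n, ℂ)} {K : Rn n × ℝ → ℂ}
    (hσ : ∀ u : 𝓢(Rn n, ℂ) →L[ℂ] ℂ,
      Integrable (fun p => K p * u (atom φ p)) (halfSpaceMeasure n) ∧
        u σ = ∫ p, K p * u (atom φ p) ∂(halfSpaceMeasure n))
    (S : ℝ → 𝓢(Rn n, ℂ)) (hS : ∀ y, 0 < y → ∀ x, K (x, y) = S y x) (ξ : Rn n) :
    𝓕 σ ξ = ∫ y in Set.Ioi (0 : ℝ), 𝓕 φ (-(y • ξ)) * 𝓕 (S y) ξ := by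
  obtain ⟨h1, h2⟩ := hσ (evalAt ξ ∘L FourierTransform.fourierCLM ℂ 𝓢(Rn n, ℂ))
  have hu : ∀ ρ : 𝓢(Rn n, ℂ),
      (evalAt ξ ∘L FourierTransform.fourierCLM ℂ 𝓢(Rn n, ℂ)) ρ = 𝓕 ρ ξ := fun ρ => rfl
  simp only [hu] at h1 h2
  rw [halfSpaceMeasure_eq_prod] at h1 h2
  rw [h2, integral_prod_symm _ h1]
  refine integral_congr_ae ?_
  filter_upwards [ae_restrict_mem measurableSet_Ioi] with y hy
  have hy : 0 < y := hy
  rw [SchwartzMap.fourier_coe (S y), Real.fourier_eq', ← integral_const_mul]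
  refine integral_congr_ae (Filter.Eventually.of_forall fun x => ?_)
  change K (x, y) * 𝓕 (atom φ (x, y)) ξ = _
  rw [fourier_atom φ (p := (x, y)) hy, hS y hy]
  simp only [smul_eq_mul]
  have : (((-2 * Real.pi * inner ℝ x ξ : ℝ) : ℂ) * Complex.I)
      = -2 * Real.pi * Complex.I * ((inner ℝ x ξ : ℝ) : ℂ) := by push_cast; ring
  rw [this]
  ring

/-- The superposition depends continuously on a parameter `ρ`, if the kernel does. -/
theorem exists_superposition_clm (φ : 𝓢(Rn n, ℂ)) {K : 𝓢(Rn n, ℂ) → Rn n × ℝ → ℂ}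
    (hadd : ∀ ρ ρ' p, K (ρ + ρ') p = K ρ p + K ρ' p) (hsmul : ∀ (c : ℂ) ρ p, K (c • ρ) p = c * K ρ p)
    (hmeas : ∀ ρ, AEStronglyMeasurable (K ρ) (halfSpaceMeasure n))
    (hbound : ∀ k l : ℕ, ∃ q : Seminorm ℂ 𝓢(Rn n, ℂ), Continuous q ∧
      ∀ ρ (p : Rn n × ℝ), 0 < p.2 → weight k l p * ‖K ρ p‖ ≤ q ρ) :
    ∃ R : 𝓢(Rn n, ℂ) →L[ℂ] 𝓢(Rn n, ℂ), ∀ ρ (u : 𝓢(Rn n, ℂ) →L[ℂ] ℂ),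
      Integrable (fun p => K ρ p * u (atom φ p)) (halfSpaceMeasure n) ∧
        u (R ρ) = ∫ p, K ρ p * u (atom φ p) ∂(halfSpaceMeasure n) := by
  have hrapid : ∀ ρ, IsRapid (K ρ) := fun ρ => ⟨hmeas ρ, fun k l => by
    obtain ⟨q, -, hq⟩ := hbound k l
    exact ⟨q ρ, hq ρ⟩⟩
  choose R hR hRs using fun ρ => exists_superposition φ (hrapid ρ)
  let A : 𝓢(Rn n, ℂ) →ₗ[ℂ] 𝓢(Rn n, ℂ) :=
    { toFun := R
      map_add' := fun ρ ρ' => by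
        ext x
        rw [add_apply, ← evalAt_apply, ← evalAt_apply, ← evalAt_apply, (hR _ _).2, (hR _ _).2,
          (hR _ _).2, ← integral_add (hR _ _).1 (hR _ _).1]
        simp only [hadd, add_mul]
      map_smul' := fun c ρ => by
        ext x
        rw [RingHom.id_apply, smul_apply, ← evalAt_apply, ← evalAt_apply, (hR _ _).2, (hR _ _).2,
          smul_eq_mul, ← integral_const_mul]
        simp only [hsmul, mul_assoc] }
  have hA : Continuous A := by
    refine ((schwartz_withSeminorms ℂ (Rn n) ℂ).continuous_iff_continuous_comp A).2 ?_
    rintro ⟨a, b⟩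
    obtain ⟨C, hC0, hC⟩ := exists_seminorm_atom_le φ a b
    obtain ⟨q, hqc, hq⟩ := hbound (n + b + a + 2) (a + (n + 1))
    set J : ℝ := ∫ p, (weight 2 (n + 1) p)⁻¹ ∂(halfSpaceMeasure n) with hJ
    have hJ0 : 0 ≤ J := integral_nonneg_of_ae (by
      filter_upwards [ae_halfSpace_pos] with p hp
      exact inv_nonneg.2 (weight_pos _ _ hp).le)
    let c : NNReal := ⟨C * J, mul_nonneg hC0 hJ0⟩
    refine Seminorm.continuous_of_le (q := c • q)
      (by
        change Continuous fun ρ => (C * J) * q ρ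
        exact continuous_const.mul hqc) fun ρ => ?_
    change SchwartzMap.seminorm ℂ a b (R ρ) ≤ (C * J) * q ρ
    refine (hRs ρ a b).trans ?_
    rw [show C * J * q ρ = (C * q ρ) * J by ring, hJ, ← integral_const_mul]
    refine integral_mono_ae (integrable_norm_mul_seminorm_atom φ (hrapid ρ) a b)
      (integrable_inv_weight.const_mul _) ?_
    filter_upwards [ae_halfSpace_pos] with p hp
    have h1 := hq ρ p hp
    rw [← weight_mul] at h1
    have h2 := weight_pos 2 (n + 1) hp
    rw [← div_eq_mul_inv, le_div_iff₀ h2]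
    calc _ ≤ ‖K ρ p‖ * (C * weight (n + b + a) a p) * weight 2 (n + 1) p := by
          gcongr; exact hC p hp
      _ = C * (weight (n + b + a) a p * weight 2 (n + 1) p * ‖K ρ p‖) := by ring
      _ ≤ C * q ρ := by gcongr
  exact ⟨⟨A, hA⟩, hR⟩

/-! ### Distributions with values in the Banach space -/

/-- A weighted bound on a kernel `K ρ` depending linearly on `ρ` makes `ρ ↦ ∫ K ρ • F` an `E`-valued
tempered distribution. -/
theorem exists_clm_integral_smul {E : Type*} [NormedAddCommGroup E] [NormedSpace ℂ E]
    {F : Rn n × ℝ → E} (hF : AEStronglyMeasurable F (halfSpaceMeasure n)) {k l : ℕ}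
    (hFw : Integrable (fun p => (weight k l p)⁻¹ * ‖F p‖) (halfSpaceMeasure n))
    {K : 𝓢(Rn n, ℂ) → Rn n × ℝ → ℂ}
    (hadd : ∀ ρ ρ' p, K (ρ + ρ') p = K ρ p + K ρ' p) (hsmul : ∀ (c : ℂ) ρ p, K (c • ρ) p = c * K ρ p)
    (hmeas : ∀ ρ, AEStronglyMeasurable (K ρ) (halfSpaceMeasure n))
    {q : Seminorm ℂ 𝓢(Rn n, ℂ)} (hqc : Continuous q)
    (hq : ∀ ρ (p : Rn n × ℝ), 0 < p.2 → weight k l p * ‖K ρ p‖ ≤ q ρ) :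
    ∃ g : 𝓢(Rn n, ℂ) →L[ℂ] E, ∀ ρ, Integrable (fun p => K ρ p • F p) (halfSpaceMeasure n) ∧
      g ρ = ∫ p, K ρ p • F p ∂(halfSpaceMeasure n) := by
  have hle : ∀ ρ, ∀ᵐ p ∂(halfSpaceMeasure n),
      ‖K ρ p • F p‖ ≤ q ρ * ((weight k l p)⁻¹ * ‖F p‖) := by
    intro ρ
    filter_upwards [ae_halfSpace_pos] with p hp
    have h2 := weight_pos k l hp
    rw [norm_smul, ← mul_assoc]
    gcongr
    rw [← div_eq_mul_inv, le_div_iff₀ h2, mul_comm]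
    exact hq ρ p hp
  have hint : ∀ ρ, Integrable (fun p => K ρ p • F p) (halfSpaceMeasure n) := fun ρ =>
    (hFw.const_mul (q ρ)).mono' ((hmeas ρ).smul hF) (hle ρ)
  let A : 𝓢(Rn n, ℂ) →ₗ[ℂ] E :=
    { toFun := fun ρ => ∫ p, K ρ p • F p ∂(halfSpaceMeasure n)
      map_add' := fun ρ ρ' => by
        rw [← integral_add (hint _) (hint _)]
        simp only [hadd, add_smul]
      map_smul' := fun c ρ => by
        rw [RingHom.id_apply, ← integral_smul]
        simp only [hsmul, mul_smul] }
  have hbd : ∀ ρ, ‖A ρ‖ ≤ q ρ * ∫ p, (weight k l p)⁻¹ * ‖F p‖ ∂(halfSpaceMeasure n) := by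
    intro ρ
    rw [← integral_const_mul]
    exact norm_integral_le_of_norm_le (hFw.const_mul _) (hle ρ)
  have hA : Continuous A := by
    refine continuous_of_continuousAt_zero A ?_
    rw [ContinuousAt, map_zero]
    refine squeeze_zero_norm hbd ?_
    have h0 : Continuous fun ρ => q ρ * ∫ p, (weight k l p)⁻¹ * ‖F p‖ ∂(halfSpaceMeasure n) :=
      hqc.mul continuous_const
    simpa using h0.tendsto 0
  exact ⟨⟨A, hA⟩, fun ρ => ⟨hint ρ, rfl⟩⟩

theorem integrable_inv_weight_mul_norm {E : Type*} [NormedAddCommGroup E]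
    {F : Rn n × ℝ → E} (hF : AEStronglyMeasurable F (halfSpaceMeasure n)) {k l : ℕ}
    (hkl : ∫⁻ p, ENNReal.ofReal (((1 / p.2 + p.2) ^ k)⁻¹ * ((1 + ‖p.1‖) ^ l)⁻¹) * ‖F p‖ₑ
      ∂(halfSpaceMeasure n) < ⊤) :
    Integrable (fun p => (weight k l p)⁻¹ * ‖F p‖) (halfSpaceMeasure n) := by
  refine ⟨(measurable_weight k l).inv.aestronglyMeasurable.mul hF.norm, ?_⟩
  refine lt_of_le_of_lt (le_of_eq (lintegral_congr_ae ?_)) hkl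
  filter_upwards [ae_halfSpace_pos] with p hp
  rw [enorm_mul, enorm_norm, ← mul_inv,
    show (1 / p.2 + p.2) ^ k * (1 + ‖p.1‖) ^ l = weight k l p from rfl,
    Real.enorm_of_nonneg (inv_nonneg.2 (weight_pos k l hp).le)]

section Separation

variable {E : Type*} [NormedAddCommGroup E] [NormedSpace ℂ E] [CompleteSpace E]
  {X : Type*} [AddCommGroup X] [Module ℂ X] [Module ℝ X] [IsScalarTower ℝ ℂ X]
  [TopologicalSpace X] [IsTopologicalAddGroup X] [ContinuousSMul ℂ X]
  [LocallyConvexSpace ℝ X] [T2Space X]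


/-- Hahn–Banach: complex functionals separate the points of a Hausdorff locally convex space. -/
theorem exists_functional_ne {x y : X} (hxy : x ≠ y) : ∃ w : X →L[ℂ] ℂ, w x ≠ w y := by
  have : ContinuousSMul ℝ X := IsScalarTower.continuousSMul ℂ
  obtain ⟨w, hw⟩ := RCLike.geometric_hahn_banach_point_point (𝕜 := ℂ) hxy
  exact ⟨w, fun h => by rw [h] at hw; exact lt_irrefl _ hw⟩

/-- A distribution commutes with superpositions of the functions `t ↦ φ_y (x - t)`: its value is
the corresponding integral of `M_φ^f`, computed in `E`. -/
theorem apply_superposition (ι : E →L[ℂ] X) (f : 𝓢'(Rn n, X)) {φ σ : 𝓢(Rn n, ℂ)}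
    {F : Rn n × ℝ → E}
    (hFM : ∀ᵐ p ∂(halfSpaceMeasure n), regTransform f φ p.1 p.2 = ι (F p))
    {K : Rn n × ℝ → ℂ}
    (hσ : ∀ u : 𝓢(Rn n, ℂ) →L[ℂ] ℂ, u σ = ∫ p, K p * u (atom φ p) ∂(halfSpaceMeasure n))
    (hint : Integrable (fun p => K p • F p) (halfSpaceMeasure n)) :
    f σ = ι (∫ p, K p • F p ∂(halfSpaceMeasure n)) := by
  by_contra hne
  obtain ⟨w, hw⟩ := exists_functional_ne hne
  refine hw ?_
  let u : 𝓢(Rn n, ℂ) →L[ℂ] ℂ :=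
    ⟨w.toLinearMap ∘ₗ (f : 𝓢(Rn n, ℂ) →ₗ[ℂ] X), w.continuous.comp (map_continuous f)⟩
  have hu : ∀ ρ, u ρ = w (f ρ) := fun ρ => rfl
  rw [← hu, hσ u, ← ContinuousLinearMap.comp_apply, ← ContinuousLinearMap.integral_comp_comm _ hint]
  refine integral_congr_ae ?_
  filter_upwards [hFM] with p hp
  rw [map_smul, ContinuousLinearMap.comp_apply, ← hp, hu, smul_eq_mul]
  rfl

end Separation

theorem isFlat_of_forall_ge {h : 𝓢(Rn n, ℂ)} (N₀ : ℕ)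
    (hh : ∀ N, N₀ ≤ N → ∃ C, ∀ u, ‖h u‖ ≤ C * ‖u‖ ^ N) : IsFlat h := by
  intro M
  obtain ⟨C, hC⟩ := hh (max N₀ M) (le_max_left _ _)
  set B := SchwartzMap.seminorm ℂ 0 0 h with hB
  have hB0 : 0 ≤ B := apply_nonneg _ _
  refine ⟨|C| + B, fun u => ?_⟩
  rcases le_total 1 ‖u‖ with h1 | h1
  · have h2 : 1 ≤ ‖u‖ ^ M := one_le_pow₀ h1
    calc ‖h u‖ ≤ B := SchwartzMap.norm_le_seminorm ℂ _ _
      _ ≤ |C| + B := by linarith [abs_nonneg C]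
      _ ≤ (|C| + B) * ‖u‖ ^ M := le_mul_of_one_le_right (by positivity) h2
  · calc ‖h u‖ ≤ C * ‖u‖ ^ max N₀ M := hC u
      _ ≤ |C| * ‖u‖ ^ M := by
        gcongr ?_ * ?_
        · exact le_abs_self C
        · exact pow_le_pow_of_le_one (norm_nonneg _) h1 (le_max_right _ _)
      _ ≤ _ := by gcongr; linarith

/-- The synthesis formula: a function whose Fourier transform is flat at the origin is the
superposition of the functions `t ↦ φ_y (x - t)` with its kernel `synthKernel`. -/
theorem eq_of_superposition_synthKernel {φ θ σ σ' : 𝓢(Rn n, ℂ)}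
    (hθ : ∀ ξ : Rn n, ξ ≠ 0 →
      ∫ y in Set.Ioi (0 : ℝ), ((y⁻¹ : ℝ) : ℂ) * (𝓕 φ (-(y • ξ)) * θ (y • ξ)) = 1)
    (hσ0 : 𝓕 σ 0 = 0)
    (hσ' : ∀ u : 𝓢(Rn n, ℂ) →L[ℂ] ℂ,
      Integrable (fun p => synthKernel θ σ p * u (atom φ p)) (halfSpaceMeasure n) ∧
        u σ' = ∫ p, synthKernel θ σ p * u (atom φ p) ∂(halfSpaceMeasure n)) :
    σ' = σ := by
  refine fourier_injective (SchwartzMap.ext fun ξ => ?_)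
  change 𝓕 σ' ξ = 𝓕 σ ξ
  rw [fourier_superposition hσ' (fun y => ((y⁻¹ : ℝ) : ℂ) • 𝓕⁻ (dilMul θ y (𝓕 σ)))
    (fun y _ x => rfl)]
  have h1 : ∀ y : ℝ, 𝓕 φ (-(y • ξ)) * 𝓕 (((y⁻¹ : ℝ) : ℂ) • 𝓕⁻ (dilMul θ y (𝓕 σ))) ξ
      = ((y⁻¹ : ℝ) : ℂ) * (𝓕 φ (-(y • ξ)) * θ (y • ξ)) * 𝓕 σ ξ := by
    intro y
    rw [FourierTransform.fourier_smul, FourierTransform.fourier_fourierInv_eq, smul_apply,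
      dilMul_apply, smul_eq_mul]
    ring
  simp_rw [h1]
  rcases eq_or_ne ξ 0 with rfl | hξ
  -- at the origin `θ (y ξ)` carries no information, but both sides vanish there
  · simp [hσ0]
  · rw [integral_mul_const, hθ ξ hξ, one_mul]

section Values

variable {E : Type*} [NormedAddCommGroup E] [NormedSpace ℂ E] [CompleteSpace E]
  {X : Type*} [AddCommGroup X] [Module ℂ X] [Module ℝ X] [IsScalarTower ℝ ℂ X]
  [TopologicalSpace X] [IsTopologicalAddGroup X] [ContinuousSMul ℂ X]
  [LocallyConvexSpace ℝ X] [T2Space X]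

/-- There is an `E`-valued tempered distribution which agrees with `f` on the functions whose
Fourier transform is flat at the origin. -/
theorem exists_clm_eq_of_isFlat (ι : E →L[ℂ] X) (f : 𝓢'(Rn n, X)) {φ : 𝓢(Rn n, ℂ)}
    (hφ : NonDegenerate φ) {F : Rn n × ℝ → E} (hF : AEStronglyMeasurable F (halfSpaceMeasure n))
    (hFM : ∀ᵐ p ∂(halfSpaceMeasure n), regTransform f φ p.1 p.2 = ι (F p)) {k l : ℕ}
    (hFw : Integrable (fun p => (weight k l p)⁻¹ * ‖F p‖) (halfSpaceMeasure n)) :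
    ∃ g : 𝓢(Rn n, ℂ) →L[ℂ] E, ∀ σ, IsFlat (𝓕 σ) → f σ = ι (g σ) := by
  obtain ⟨θ, a, b, hθ, hrec⟩ := exists_reconstruction (𝓕 φ) (fun e he => by
    obtain ⟨r, hr, hne⟩ := hφ e he
    refine ⟨(2 * Real.pi)⁻¹ * r, by positivity, ?_⟩
    rw [mul_smul]
    exact hne)
  obtain ⟨N, q, hqc, hq⟩ := exists_weight_mul_synthKernel_le hθ k l
  obtain ⟨T, hT, hT'⟩ := exists_projection_vanishesToOrder n N
  obtain ⟨g, hg⟩ := exists_clm_integral_smul hF hFw (K := fun ρ => synthKernel θ (T ρ))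
    (q := q.comp T.toLinearMap)
    (fun ρ ρ' p => by rw [map_add, synthKernel_add])
    (fun c ρ p => by rw [map_smul, synthKernel_smul])
    (fun ρ => (measurable_synthKernel θ _).aestronglyMeasurable)
    (hqc.comp T.continuous) (fun ρ p hp => hq (T ρ) (hT ρ) p hp)
  refine ⟨g, fun σ hσ => ?_⟩
  -- the projection `T` fixes `σ`, and the superposition with its kernel is `σ` itself
  obtain ⟨σ', hσ', -⟩ := exists_superposition φ (isRapid_synthKernel hθ hσ.vanishesToOrder)
  obtain rfl := eq_of_superposition_synthKernel hrec hσ.apply_zero hσ'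
  obtain ⟨hint, hgσ⟩ := hg σ'
  rw [hT' _ (hσ.vanishesToOrder N)] at hint hgσ
  rw [hgσ]
  exact apply_superposition ι f hFM (fun u => (hσ' u).2) hint

/-- The superposition `ρ_κ` with the kernel `κ (y) ρ (x)`, and the value of `f` on it. -/
theorem exists_clm_moment_superposition (ι : E →L[ℂ] X) (f : 𝓢'(Rn n, X)) {φ : 𝓢(Rn n, ℂ)}
    {F : Rn n × ℝ → E} (hF : AEStronglyMeasurable F (halfSpaceMeasure n))
    (hFM : ∀ᵐ p ∂(halfSpaceMeasure n), regTransform f φ p.1 p.2 = ι (F p)) {k l : ℕ}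
    (hFw : Integrable (fun p => (weight k l p)⁻¹ * ‖F p‖) (halfSpaceMeasure n))
    {q : ℕ} {κ : ℝ → ℂ} (hκ : IsMomentFunction q κ) :
    ∃ (R : 𝓢(Rn n, ℂ) →L[ℂ] 𝓢(Rn n, ℂ)) (h : 𝓢(Rn n, ℂ) →L[ℂ] E),
      (∀ ρ, f (R ρ) = ι (h ρ)) ∧
      ∀ ρ ξ, 𝓕 (R ρ) ξ = (∫ y in Set.Ioi (0 : ℝ), κ y * 𝓕 φ (-(y • ξ))) * 𝓕 ρ ξ := by
  let K : 𝓢(Rn n, ℂ) → Rn n × ℝ → ℂ := fun ρ p => κ p.2 * ρ p.1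
  have hadd : ∀ ρ ρ' p, K (ρ + ρ') p = K ρ p + K ρ' p := fun ρ ρ' p => mul_add _ _ _
  have hsmul : ∀ (c : ℂ) ρ p, K (c • ρ) p = c * K ρ p := fun c ρ p => mul_left_comm _ _ _
  have hmeas : ∀ ρ, AEStronglyMeasurable (K ρ) (halfSpaceMeasure n) := fun ρ =>
    ((hκ.meas.comp measurable_snd).mul
      (ρ.continuous.measurable.comp measurable_fst)).aestronglyMeasurable
  have hbound : ∀ k l : ℕ, ∃ q : Seminorm ℂ 𝓢(Rn n, ℂ), Continuous q ∧
      ∀ ρ (p : Rn n × ℝ), 0 < p.2 → weight k l p * ‖K ρ p‖ ≤ q ρ := by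
    intro k l
    obtain ⟨C, hC⟩ := hκ.bound k
    let S : Seminorm ℂ 𝓢(Rn n, ℂ) :=
      (Finset.Iic (l, 0)).sup (fun m : ℕ × ℕ => SchwartzMap.seminorm ℂ m.1 m.2)
    have hS : Continuous S := Seminorm.continuous_of_le (continuous_seminorm_sum _ fun m _ =>
      (schwartz_withSeminorms ℂ (Rn n) ℂ).continuous_seminorm m) (Seminorm.finset_sup_le_sum _ _)
    have hC0 : 0 ≤ C := le_trans (by positivity) (hC 1 one_pos)
    let c : NNReal := ⟨C * 2 ^ l, by positivity⟩
    refine ⟨c • S, ?_, fun ρ p hp => ?_⟩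
    · change Continuous fun ρ => (C * 2 ^ l) * S ρ
      exact continuous_const.mul hS
    · change _ ≤ C * 2 ^ l * S ρ
      have h1 := SchwartzMap.one_add_le_sup_seminorm_apply (𝕜 := ℂ) (m := (l, 0)) (k := l) (n := 0)
        le_rfl le_rfl ρ p.1
      rw [norm_iteratedFDeriv_zero] at h1
      calc weight k l p * ‖K ρ p‖
          = ((1 / p.2 + p.2) ^ k * ‖κ p.2‖) * ((1 + ‖p.1‖) ^ l * ‖ρ p.1‖) := by
            rw [norm_mul, weight]; ring
        _ ≤ C * (2 ^ l * S ρ) := mul_le_mul (hC _ hp) h1 (by positivity) hC0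
        _ = _ := by ring
  obtain ⟨R, hR⟩ := exists_superposition_clm φ hadd hsmul hmeas hbound
  obtain ⟨S, hSc, hS⟩ := hbound k l
  obtain ⟨h, hh⟩ := exists_clm_integral_smul hF hFw hadd hsmul hmeas hSc hS
  refine ⟨R, h, fun ρ => ?_, fun ρ ξ => ?_⟩
  · rw [(hh ρ).2]
    exact apply_superposition ι f hFM (fun u => (hR ρ u).2) (hh ρ).1
  · rw [fourier_superposition (hR ρ) (fun y => κ y • ρ) (fun y _ x => rfl), ← integral_mul_const]
    refine integral_congr_ae (Filter.Eventually.of_forall fun y => ?_)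
    simp only [FourierTransform.fourier_smul, smul_apply, smul_eq_mul]
    ring

/-- The low frequency part of `ρ_κ` is the Taylor term `P_q(∂)` applied to `ρ`: the difference has a
Fourier transform that is flat at the origin. -/
theorem isFlat_fourier_sub {φ : 𝓢(Rn n, ℂ)} {q : ℕ} {κ : ℝ → ℂ} (hκ : IsMomentFunction q κ)
    {ρ r d : 𝓢(Rn n, ℂ)}
    (hr : ∀ ξ, 𝓕 r ξ = (∫ y in Set.Ioi (0 : ℝ), κ y * 𝓕 φ (-(y • ξ))) * 𝓕 ρ ξ)
    (hd : ∀ ξ, 𝓕 d ξ = (-(2 * Real.pi * Complex.I)) ^ q *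
        ((q.factorial : ℂ)⁻¹ * iteratedFDeriv ℝ q (fourierS n φ) 0 fun _ => ξ) * 𝓕 ρ ξ) :
    IsFlat (𝓕 (Complex.I ^ q • r - d)) := by
  refine isFlat_of_forall_ge (q + 1) fun M hM => ?_
  obtain ⟨N, rfl⟩ : ∃ N, M = N + 1 := ⟨M - 1, by omega⟩
  obtain ⟨C, hC⟩ := exists_integral_moment_sub_le hκ (fourierS n φ) (by omega : q ≤ N)
  refine ⟨C * (2 * Real.pi) ^ (N + 1) * SchwartzMap.seminorm ℂ 0 0 (𝓕 ρ), fun ξ => ?_⟩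
  have h1 := hC ((2 * Real.pi) • ξ)
  have h2 : ∀ y : ℝ, fourierS n φ (-(y • (2 * Real.pi) • ξ)) = 𝓕 φ (-(y • ξ)) := by
    intro y
    change 𝓕 φ ((2 * Real.pi)⁻¹ • (-(y • (2 * Real.pi) • ξ))) = _
    rw [smul_neg, smul_comm y, smul_smul, inv_mul_cancel₀ Real.two_pi_pos.ne', one_smul]
  have h3 := (iteratedFDeriv ℝ q (fourierS n φ) 0).map_smul_univ (fun _ => 2 * Real.pi)
    (fun _ => ξ)
  simp only [Finset.prod_const, Finset.card_univ, Fintype.card_fin] at h3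
  simp_rw [h2] at h1
  rw [h3, Complex.real_smul, norm_smul, Real.norm_of_nonneg Real.two_pi_pos.le] at h1
  rw [sub_eq_add_neg, FourierTransform.fourier_add, FourierTransform.fourier_neg,
    FourierTransform.fourier_smul, add_apply, neg_apply, smul_apply, hr, hd, smul_eq_mul]
  set A := ∫ y in Set.Ioi (0 : ℝ), κ y * 𝓕 φ (-(y • ξ)) with hA
  set B := iteratedFDeriv ℝ q (fourierS n φ) 0 fun _ => ξ with hB
  have h4 : Complex.I ^ q * (A * 𝓕 ρ ξ)
      + -((-(2 * Real.pi * Complex.I)) ^ q * ((q.factorial : ℂ)⁻¹ * B) * 𝓕 ρ ξ)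
      = Complex.I ^ q * ((A - (-1) ^ q * ((q.factorial : ℂ)⁻¹ *
        ((((2 * Real.pi) ^ q : ℝ) : ℂ) * B))) * 𝓕 ρ ξ) := by
    rw [neg_pow, mul_pow (2 * Real.pi : ℂ) Complex.I]
    push_cast
    ring
  rw [h4, norm_mul, norm_pow, Complex.norm_I, one_pow, one_mul, norm_mul]
  calc _ ≤ C * (2 * Real.pi * ‖ξ‖) ^ (N + 1) * SchwartzMap.seminorm ℂ 0 0 (𝓕 ρ) :=
        mul_le_mul h1 (SchwartzMap.norm_le_seminorm ℂ _ _) (norm_nonneg _)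
          ((norm_nonneg _).trans h1)
    _ = _ := by rw [mul_pow]; ring

end Values

theorem fourier_fourierS_apply (ρ : 𝓢(Rn n, ℂ)) (ξ : Rn n) :
    ∃ c : ℂ, 𝓕 (fourierS n ρ) ξ = c * ρ (-((2 * Real.pi) • ξ)) := by
  refine ⟨(((2 * Real.pi) ^ n : ℝ) : ℂ), ?_⟩
  rw [SchwartzMap.fourier_coe, Real.fourier_eq']
  let h : Rn n → ℂ := fun w =>
    Complex.exp (↑(2 * Real.pi * inner ℝ w (-((2 * Real.pi) • ξ))) * Complex.I) • 𝓕 ρ w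
  have h1 : ∀ v : Rn n, Complex.exp (↑(-2 * Real.pi * inner ℝ v ξ) * Complex.I)
      • fourierS n ρ v = h ((2 * Real.pi)⁻¹ • v) := by
    intro v
    change _ • 𝓕 ρ ((2 * Real.pi)⁻¹ • v) = _
    simp only [h, inner_neg_right, inner_smul_right, inner_smul_left]
    congr 4
    simp
    field_simp
  simp_rw [h1]
  have h2 : ∫ w, h w = ρ (-((2 * Real.pi) • ξ)) := by
    rw [← Real.fourierInv_eq', ← SchwartzMap.fourierInv_coe,
      FourierTransform.fourierInv_fourier_eq]
  rw [Measure.integral_comp_smul, h2]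
  simp only [finrank_euclideanSpace, Fintype.card_fin, inv_pow, inv_inv]
  rw [abs_of_pos (by positivity), Complex.real_smul]

/-- If `ρ` vanishes near the origin, so does the second transform, a multiple of `ρ (-2π ·)`. -/
theorem isFlat_fourier_fourierS {ρ : 𝓢(Rn n, ℂ)} (hρ : tsupport ρ ⊆ {0}ᶜ) :
    IsFlat (𝓕 (fourierS n ρ)) := by
  refine isFlat_of_eventually_eq_zero ?_
  have h0 : ∀ᶠ v in nhds (0 : Rn n), ρ v = 0 :=
    notMem_tsupport_iff_eventuallyEq.1 fun h => hρ h rfl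
  have hc : Continuous fun ξ : Rn n => -((2 * Real.pi) • ξ) := by fun_prop
  have ht := hc.tendsto 0
  simp only [smul_zero, neg_zero] at ht
  filter_upwards [ht.eventually h0] with ξ hξ
  obtain ⟨c, hc⟩ := fourier_fourierS_apply ρ ξ
  rw [hc, hξ, mul_zero]

end ClassEstimate

end

theorem mainTheorem1 (n : ℕ)
    {E : Type*} [NormedAddCommGroup E] [NormedSpace ℂ E] [CompleteSpace E]
    {X : Type*} [AddCommGroup X] [Module ℂ X] [Module ℝ X] [IsScalarTower ℝ ℂ X]
    [TopologicalSpace X] [IsTopologicalAddGroup X] [ContinuousSMul ℂ X]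
    [LocallyConvexSpace ℝ X] [T2Space X]
    (ι : E →L[ℂ] X) (hι : Function.Injective ι)
    (f : 𝓢'(ClassEstimate.Rn n, X)) (φ : 𝓢(ClassEstimate.Rn n, ℂ))
    (hφ : ClassEstimate.NonDegenerate φ)
    (F : ClassEstimate.Rn n × ℝ → E)
    (hF : AEStronglyMeasurable F (ClassEstimate.halfSpaceMeasure n))
    (hFM : ∀ᵐ p ∂(ClassEstimate.halfSpaceMeasure n),
      ClassEstimate.regTransform f φ p.1 p.2 = ι (F p))
    (k l : ℕ)
    (hkl : ∫⁻ p, ENNReal.ofReal (((1 / p.2 + p.2) ^ k)⁻¹ * ((1 + ‖p.1‖) ^ l)⁻¹) * ‖F p‖ₑ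
      ∂(ClassEstimate.halfSpaceMeasure n) < ⊤) :
    (∃ G : 𝓢'(ClassEstimate.Rn n, X),
      ClassEstimate.IsValuedIn ι (f - G) ∧
      Distribution.dsupport (ClassEstimate.fourierD G) ⊆ {0}) ∧
    ∀ q : ℕ, ClassEstimate.IsValuedIn ι
      (ClassEstimate.diffOp (ClassEstimate.taylorTerm φ q) f) := by
  have hFw := ClassEstimate.integrable_inv_weight_mul_norm hF hkl
  obtain ⟨g, hg⟩ := ClassEstimate.exists_clm_eq_of_isFlat ι f hφ hF hFM hFw
  refine ⟨⟨f - ContinuousLinearMap.toPointwiseConvergenceCLM ℂ _ _ _ (ι ∘L g), ?_, ?_⟩,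
    fun q => ?_⟩
  · refine ⟨ContinuousLinearMap.toPointwiseConvergenceCLM ℂ _ _ _ g, fun ρ => ?_⟩
    rw [sub_sub_cancel]
    rfl
  · intro x hx
    by_contra hx0
    refine (Distribution.notMem_dsupport_iff x).2
      ⟨{0}ᶜ, fun ρ hρ => ?_, isOpen_compl_singleton, hx0⟩ hx
    change f (ClassEstimate.fourierS n ρ) - ι (g (ClassEstimate.fourierS n ρ)) = 0
    rw [hg _ (ClassEstimate.isFlat_fourier_fourierS hρ), sub_self]
  · obtain ⟨κ, hκ⟩ := ClassEstimate.exists_isMomentFunction q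
    obtain ⟨R, h, hR, hR'⟩ :=
      ClassEstimate.exists_clm_moment_superposition ι f hF hFM hFw hκ
    obtain ⟨D, hD, hD'⟩ := ClassEstimate.exists_transpose_taylorTerm f φ q
    refine ⟨ContinuousLinearMap.toPointwiseConvergenceCLM ℂ _ _ _
      (Complex.I ^ q • h - g ∘L (Complex.I ^ q • R - D)), fun ρ => ?_⟩
    have hflat := ClassEstimate.isFlat_fourier_sub hκ (hR' ρ) (hD' ρ)
    change _ = ι (Complex.I ^ q • h ρ - g (Complex.I ^ q • R ρ - D ρ))
    rw [hD, map_sub, map_smul, ← hR, ← hg _ hflat, map_sub, map_smul, sub_sub_cancel]
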